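/- **Theorem (public event scheduling with busy agents, one event).** An instance consists of a timeline $T=\{1,\dots,N\}$ of time slots ($N\ge 1$), one event of length $l\ge 1$, and finitely many agents, where agent $i$ has a finite job set $J_i$. Each job $j$ has a release time $r_j\ge1$, a deadline $d_j\ge1$ and a processing time $p_j\ge1$ with $p_j\le d_j-r_j+1$. A feasible job schedule of agent $i$ is preemptive: each job $j\in J_i$ is assigned exactly $p_j$ slots of $T\cap\{r_j,\dots,d_j\}$, and at most one job is processed in each slot; it is assumed that every agent has a feasible job schedule. If the event is scheduled at $t\in T$, it occupies the slots of $T$ among $t,t+1,\dots,t+l-1$. An agreement slot of an agent is an occupied slot in which the agent processes no job, and $g_i(t)$ denotes the maximum number of agreement slots of agent $i$ over all feasible job schedules of $J_i$ when the event is scheduled at $t$. The numbers of the instance are given in binary, and polynomial time means time polynomial in the bit length of the input (on a random access machine with addition, truncated subtraction and comparison under the logarithmic cost criterion). 1. There is a polynomial-time algorithm that, for every such instance, returns a slot $t^*\in T$ with $\sum_i g_i(t^*)=\max_{t\in T}\sum_i g_i(t)$; moreover $t^*+l-1\le N$ whenever $l\le N$, so that the event then lies entirely in the timeline. 2. Call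 $t$ with $1<t<N$ a turning point of $g_i$ if $g_i(t+1)-g_i(t)\ne g_i(t)-g_i(t-1)$. Each $g_i:T\to\mathbb N$ is piecewise linear, i.e. linear between consecutive elements of the set consisting of $1$, $N$ and the turning points of $g_i$; and there is a polynomial $q$, the same for all instances and agents, such that $g_i$ has at most $q(|J_i|)$ turning points. 3. There is a polynomial-time algorithm that, given $N$, $l$ and the job set $J_i$ of one agent, outputs a list of pairs $(t,g_i(t))$ with $t\in T$ in which $1$, $N$ and all turning points of $g_i$ occur as $t$. -/

import Mathlib

/-! ### A random access machine with logarithmic cost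

Programs are structured imperative programs over finitely many registers and arrays of natural
numbers.  The arithmetic is addition, truncated subtraction and comparison; each operation is
charged the bit lengths of the numbers it handles (the logarithmic cost criterion), so that
"polynomial time" has its usual meaning for inputs written in binary. -/

namespace RAM

/-- Contents of the registers (`reg x`) and of the arrays (`arr a i` is cell `i` of array `a`). -/
structure Store where
  reg : ℕ → ℕ
  arr : ℕ → ℕ → ℕ

inductive Expr where
  | lit (n : ℕ)
  | reg (x : ℕ)
  | get (a : ℕ) (i : Expr)
  | add (e₁ e₂ : Expr)
  | sub (e₁ e₂ : Expr)
  | lt (e₁ e₂ : Expr)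
  | eq (e₁ e₂ : Expr)

def Expr.eval (s : Store) : Expr → ℕ
  | .lit n => n
  | .reg x => s.reg x
  | .get a i => s.arr a (i.eval s)
  | .add e₁ e₂ => e₁.eval s + e₂.eval s
  | .sub e₁ e₂ => e₁.eval s - e₂.eval s
  | .lt e₁ e₂ => if e₁.eval s < e₂.eval s then 1 else 0
  | .eq e₁ e₂ => if e₁.eval s = e₂.eval s then 1 else 0

/-- Logarithmic cost of an evaluation: one, plus the bit length of the value, for the expression
and for each of its subexpressions. -/
def Expr.cost (s : Store) : Expr → ℕ
  | .lit n => 1 + n.size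
  | .reg x => 1 + (s.reg x).size
  | .get a i => i.cost s + 1 + (s.arr a (i.eval s)).size
  | .add e₁ e₂ => e₁.cost s + e₂.cost s + 1 + (e₁.eval s + e₂.eval s).size
  | .sub e₁ e₂ => e₁.cost s + e₂.cost s + 1 + (e₁.eval s - e₂.eval s).size
  | .lt e₁ e₂ => e₁.cost s + e₂.cost s + 2
  | .eq e₁ e₂ => e₁.cost s + e₂.cost s + 2

inductive Program where
  | skip
  | assign (x : ℕ) (e : Expr)
  | put (a : ℕ) (i e : Expr)
  | seq (c₁ c₂ : Program)
  | ite (b : Expr) (c₁ c₂ : Program)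
  | loop (b : Expr) (c : Program)

def Store.setReg (s : Store) (x v : ℕ) : Store :=
  ⟨Function.update s.reg x v, s.arr⟩

def Store.setArr (s : Store) (a i v : ℕ) : Store :=
  ⟨s.reg, Function.update s.arr a (Function.update (s.arr a) i v)⟩

/-- `Exec c s s' n`: program `c`, started in `s`, halts in `s'`, and the run costs `n`.
A test counts as true if its value is not zero; `loop b c` repeats `c` while `b` is true. -/
inductive Exec : Program → Store → Store → ℕ → Prop
  | skip (s : Store) : Exec .skip s s 1
  | assign (s : Store) (x : ℕ) (e : Expr) :
      Exec (.assign x e) s (s.setReg x (e.eval s)) (e.cost s + 1)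
  | put (s : Store) (a : ℕ) (i e : Expr) :
      Exec (.put a i e) s (s.setArr a (i.eval s) (e.eval s)) (i.cost s + e.cost s + 1)
  | seq {c₁ c₂ : Program} {s s' s'' : Store} {n m : ℕ} :
      Exec c₁ s s' n → Exec c₂ s' s'' m → Exec (.seq c₁ c₂) s s'' (n + m)
  | iteTrue {b : Expr} {c₁ c₂ : Program} {s s' : Store} {n : ℕ} :
      b.eval s ≠ 0 → Exec c₁ s s' n → Exec (.ite b c₁ c₂) s s' (b.cost s + 1 + n)
  | iteFalse {b : Expr} {c₁ c₂ : Program} {s s' : Store} {n : ℕ} :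
      b.eval s = 0 → Exec c₂ s s' n → Exec (.ite b c₁ c₂) s s' (b.cost s + 1 + n)
  | loopTrue {b : Expr} {c : Program} {s s' s'' : Store} {n m : ℕ} :
      b.eval s ≠ 0 → Exec c s s' n → Exec (.loop b c) s' s'' m →
      Exec (.loop b c) s s'' (b.cost s + 1 + n + m)
  | loopFalse {b : Expr} {c : Program} {s : Store} :
      b.eval s = 0 → Exec (.loop b c) s s (b.cost s + 1)

/-- The input is stored in array `0` and its length in register `0`; all else is zero. -/
def inputStore (inp : List ℕ) : Store where
  reg x := if x = 0 then inp.length else 0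
  arr a i := if a = 0 then inp.getD i 0 else 0

/-- The output is read from array `0`, its length from register `0`. -/
def Store.output (s : Store) : List ℕ := (List.range (s.reg 0)).map (s.arr 0)

/-- Number of symbols of a list of numbers in binary, with one separator per number. -/
def bitSize (inp : List ℕ) : ℕ := (inp.map fun x => x.size + 1).sum

/-- On input `inp` the program halts with output `out`, at a cost of at most `B`. -/
def Program.OutputsWithin (c : Program) (inp out : List ℕ) (B : ℕ) : Prop :=
  ∃ (s : Store) (n : ℕ), Exec c (inputStore inp) s n ∧ s.output = out ∧ n ≤ B

end RAM

/-! ### Public event scheduling with busy agents -/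

namespace PSBA

/-- A job; its job interval consists of the time slots `release, …, deadline`. -/
structure Job where
  release : ℕ
  deadline : ℕ
  processing : ℕ

def Job.Valid (j : Job) : Prop :=
  1 ≤ j.release ∧ 1 ≤ j.deadline ∧ 1 ≤ j.processing ∧ j.processing + j.release ≤ j.deadline + 1

/-- The set of time slots `1, …, N`. -/
def timeline (N : ℕ) : Finset ℕ := Finset.Icc 1 N

/-- A preemptive schedule of one agent's jobs: the job processed in each slot, `none` if idle. -/
abbrev JobSchedule (J : List Job) : Type := ℕ → Option (Fin J.length)

/-- Jobs are processed within the timeline and their job intervals, and each job gets exactly its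
processing time. -/
def JobSchedule.Feasible {J : List Job} (s : JobSchedule J) (N : ℕ) : Prop :=
  (∀ t j, s t = some j →
    t ∈ timeline N ∧ (J.get j).release ≤ t ∧ t ≤ (J.get j).deadline) ∧
  ∀ j, ((timeline N).filter fun t => s t = some j).card = (J.get j).processing

/-- The number of agreement slots if the events occupy the slots `S`. -/
def JobSchedule.agreement {J : List Job} (s : JobSchedule J) (S : Finset ℕ) : ℕ :=
  (S.filter fun t => s t = none).card

/-- The maximum agreement of an agent with jobs `J` if the events occupy the slots `S`. -/
noncomputable def agr (N : ℕ) (J : List Job) (S : Finset ℕ) : ℕ :=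
  sSup {a | ∃ s : JobSchedule J, s.Feasible N ∧ s.agreement S = a}

/-- Time slots `1, …, horizon`, the lengths of the events, and the job set of each agent. -/
structure Instance where
  horizon : ℕ
  events : List ℕ
  agents : List (List Job)

namespace Instance

def Valid (I : Instance) : Prop :=
  1 ≤ I.horizon ∧ (∀ l ∈ I.events, 1 ≤ l) ∧
  ∀ J ∈ I.agents, (∀ j ∈ J, j.Valid) ∧ ∃ s : JobSchedule J, s.Feasible I.horizon

/-- A complete event schedule gives each event its first time slot. -/
abbrev EventSchedule (I : Instance) : Type := Fin I.events.length → ℕ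

/-- Every event is scheduled at some time slot of the timeline. -/
def IsSchedule (I : Instance) (τ : I.EventSchedule) : Prop := ∀ e, τ e ∈ timeline I.horizon

/-- The slots of the timeline that are occupied by some event. -/
def occupied (I : Instance) (τ : I.EventSchedule) : Finset ℕ :=
  (timeline I.horizon).filter fun t => ∃ e, τ e ≤ t ∧ t < τ e + I.events.get e

noncomputable def totalAgreement (I : Instance) (τ : I.EventSchedule) : ℕ :=
  (I.agents.map fun J => agr I.horizon J (I.occupied τ)).sum

def IsOptimal (I : Instance) (τ : I.EventSchedule) : Prop :=
  I.IsSchedule τ ∧ ∀ τ', I.IsSchedule τ' → I.totalAgreement τ' ≤ I.totalAgreement τ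

/-- No event that can be held entirely within the timeline extends beyond its end. -/
def StaysInside (I : Instance) (τ : I.EventSchedule) : Prop :=
  ∀ e, I.events.get e ≤ I.horizon → τ e + I.events.get e ≤ I.horizon + 1

/-- For an instance with one event: the agreement function `g` of an agent with jobs `J`, that is,
the maximum agreement if the event is scheduled at slot `t`. -/
noncomputable def g (I : Instance) (J : List Job) (t : ℕ) : ℕ :=
  agr I.horizon J (I.occupied fun _ => t)

/-- The instance as a list of numbers: the horizon, the number of events and their lengths, the
number of agents, and for each agent the number of jobs and the data of each job. -/
def encode (I : Instance) : List ℕ :=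
  [I.horizon, I.events.length] ++ I.events ++ [I.agents.length] ++
    I.agents.flatMap fun J =>
      J.length :: J.flatMap fun j => [j.release, j.deadline, j.processing]

end Instance

/-- The slots strictly inside `1, …, N` at which the slope of `f` changes. -/
def turningPoints (N : ℕ) (f : ℕ → ℕ) : Finset ℕ :=
  (Finset.Ioo 1 N).filter fun t =>
    ((f (t + 1) : ℤ) - (f t : ℤ)) ≠ (f t : ℤ) - (f (t - 1) : ℤ)

/-- `f` is linear on `a, …, b` whenever `a < b` are consecutive elements of `B`. -/
def LinearBetween (B : Finset ℕ) (f : ℕ → ℕ) : Prop :=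
  ∀ a ∈ B, ∀ b ∈ B, a < b → (∀ c ∈ B, ¬ (a < c ∧ c < b)) →
    ∀ t ∈ Finset.Icc a b,
      ((f t : ℤ) - (f a : ℤ)) * ((b : ℤ) - (a : ℤ)) =
        ((f b : ℤ) - (f a : ℤ)) * ((t : ℤ) - (a : ℤ))

end PSBA

/-!
An event that demands `D` agreement slots of an agent is nothing but one more job, with processing
time `D` and the occupied slots `S` as its interval.  By Hall's theorem a set of jobs is feasible if
and only if no interval of slots has to accommodate jobs of a greater total processing time than its
length (`exists_schedule_of_interval_bound`).  It follows that the agreement function is a minimum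
of explicit functions, one for the empty interval and one for each pair of a release time `a` and a deadline
`b`: the number of slots covered by `S` and `a, …, b` together, minus the processing time of the jobs
confined to `a, …, b` (`agr_eq_leastCapacity`).

As functions of the slot of the event, these capacities have slopes `-1`, `0`, `1` and turn at five
explicit points only.  A turning point of their minimum is one of these, or it is next to a crossing
of two capacities, at a distance from the last such point that is, up to `1`, the difference of the
two values there, or half of it (`exists_crossing`).  So there is an explicit list of candidates, of
length polynomial in the number of jobs, that contains all turning points
(`isCandidate_of_turning`).  The sum over the agents is maximal at an end of the range of slots to be
considered or at a turning point of one agreement function (`exists_optimal`), so that it suffices to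
try the candidates.

The programs are obtained from a calculus of functions `RAM.Comp` with the machine operations, case
distinction, and iteration.  Every iteration makes as many rounds as one number `M` says, which is
the length of the input plus the bit length of the horizon; hence the number of steps is polynomial
in `M`.  A bound on the logarithmic cost comes for free, since one operation lengthens the numbers
by at most one bit (`RAM.Runs`).  The output is a list that is emitted in nested loops
(`RAM.Emits.exists_program`).
-/

/-! ### The cost of a run, in terms of a single resource number -/

namespace RAM

/-- All numbers in the store have at most `W` bits. -/
def Store.SizeLe (s : Store) (W : ℕ) : Prop :=
  (∀ x, (s.reg x).size ≤ W) ∧ ∀ a i, (s.arr a i).size ≤ W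

/-- A syntactic weight of an expression that bounds both how many bits its value can have beyond
those of the store, and the number of operations it performs. -/
def Expr.weight : Expr → ℕ
  | .lit n => 1 + n.size
  | .reg _ => 1
  | .get _ i => i.weight + 1
  | .add e₁ e₂ => e₁.weight + e₂.weight + 1
  | .sub e₁ e₂ => e₁.weight + e₂.weight + 1
  | .lt e₁ e₂ => e₁.weight + e₂.weight + 1
  | .eq e₁ e₂ => e₁.weight + e₂.weight + 1

theorem Expr.one_le_weight (e : Expr) : 1 ≤ e.weight := by
  cases e <;> simp only [Expr.weight] <;> omega

theorem size_add_le {a b W : ℕ} (ha : a.size ≤ W) (hb : b.size ≤ W) : (a + b).size ≤ W + 1 := by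
  rw [Nat.size_le] at *
  rw [pow_succ]
  omega

theorem Expr.size_eval_le {s : Store} {W : ℕ} (h : s.SizeLe W) (e : Expr) :
    (e.eval s).size ≤ W + e.weight := by
  induction e with
  | lit n => simp only [Expr.eval, Expr.weight]; omega
  | reg x => simp only [Expr.eval, Expr.weight]; have := h.1 x; omega
  | get a i ih => simp only [Expr.eval, Expr.weight]; have := h.2 a (i.eval s); omega
  | add e₁ e₂ h₁ h₂ =>
    simp only [Expr.eval, Expr.weight]
    have := size_add_le (W := W + (e₁.weight + e₂.weight)) (a := e₁.eval s) (b := e₂.eval s)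
      (by omega) (by omega)
    omega
  | sub e₁ e₂ h₁ h₂ =>
    simp only [Expr.eval, Expr.weight]
    have := Nat.size_le_size (Nat.sub_le (e₁.eval s) (e₂.eval s))
    omega
  | lt e₁ e₂ h₁ h₂ =>
    simp only [Expr.eval, Expr.weight]
    split_ifs <;> simp
    omega
  | eq e₁ e₂ h₁ h₂ =>
    simp only [Expr.eval, Expr.weight]
    split_ifs <;> simp
    omega

theorem Expr.cost_le {s : Store} {W : ℕ} (h : s.SizeLe W) (e : Expr) :
    e.cost s ≤ e.weight * (W + e.weight) := by
  induction e with
  | lit n => simp only [Expr.cost, Expr.weight]; nlinarith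
  | reg x => simp only [Expr.cost, Expr.weight]; have := h.1 x; omega
  | get a i ih =>
    simp only [Expr.cost, Expr.weight]; have := h.2 a (i.eval s); nlinarith
  | add e₁ e₂ h₁ h₂ =>
    have := (Expr.add e₁ e₂).size_eval_le h
    simp only [Expr.cost, Expr.weight, Expr.eval] at *
    have := e₁.one_le_weight
    have := e₂.one_le_weight
    nlinarith
  | sub e₁ e₂ h₁ h₂ =>
    have := (Expr.sub e₁ e₂).size_eval_le h
    simp only [Expr.cost, Expr.weight, Expr.eval] at *
    have := e₁.one_le_weight
    have := e₂.one_le_weight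
    nlinarith
  | lt e₁ e₂ h₁ h₂ =>
    simp only [Expr.cost, Expr.weight]
    have := e₁.one_le_weight
    have := e₂.one_le_weight
    nlinarith
  | eq e₁ e₂ h₁ h₂ =>
    simp only [Expr.cost, Expr.weight]
    have := e₁.one_le_weight
    have := e₂.one_le_weight
    nlinarith

/-- `c` takes `s` to `s'` with resources `A`: the numbers grow by at most `A` bits, and the cost is
at most `A * (W + A)` if the run starts with numbers of at most `W` bits.  As a sum or difference
has at most one bit more than its operands, resources just add up along a run, which makes a
separate bound on the numbers unnecessary. -/
def Runs (c : Program) (s s' : Store) (A : ℕ) : Prop :=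
  ∀ W, s.SizeLe W → s'.SizeLe (W + A) ∧ ∃ n ≤ A * (W + A), Exec c s s' n

theorem Store.SizeLe.mono {s : Store} {W W' : ℕ} (h : s.SizeLe W) (hW : W ≤ W') : s.SizeLe W' :=
  ⟨fun x => (h.1 x).trans hW, fun a i => (h.2 a i).trans hW⟩

theorem Runs.mono {c : Program} {s s' : Store} {A B : ℕ} (h : Runs c s s' A) (hAB : A ≤ B) :
    Runs c s s' B := by
  intro W hW
  obtain ⟨h₁, n, hn, h₂⟩ := h W hW
  exact ⟨h₁.mono (by omega), n, hn.trans (by gcongr), h₂⟩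

theorem Runs.assign (s : Store) (x : ℕ) (e : Expr) :
    Runs (.assign x e) s (s.setReg x (e.eval s)) (e.weight + 1) := by
  intro W hW
  have h₁ := e.size_eval_le hW
  have h₂ := e.cost_le hW
  refine ⟨⟨fun y => ?_, fun a i => (hW.2 a i).trans (by omega)⟩, _, ?_, Exec.assign s x e⟩
  · simp only [Store.setReg, Function.update_apply]
    have := hW.1 y
    split_ifs <;> omega
  · nlinarith

theorem Runs.put (s : Store) (a : ℕ) (i e : Expr) :
    Runs (.put a i e) s (s.setArr a (i.eval s) (e.eval s)) (i.weight + e.weight + 1) := by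
  intro W hW
  have h₁ := e.size_eval_le hW
  have h₂ := e.cost_le hW
  have h₃ := i.cost_le hW
  refine ⟨⟨fun y => (hW.1 y).trans (by omega), fun b k => ?_⟩, _, ?_, Exec.put s a i e⟩
  · have := hW.2 b k
    by_cases hb : b = a
    · subst hb
      simp only [Store.setArr, Function.update_self, Function.update_apply]
      split_ifs <;> omega
    · simp only [Store.setArr, Function.update_of_ne hb]
      omega
  · nlinarith

theorem Runs.seq {c₁ c₂ : Program} {s s' s'' : Store} {A B : ℕ} (h₁ : Runs c₁ s s' A)
    (h₂ : Runs c₂ s' s'' B) : Runs (.seq c₁ c₂) s s'' (A + B) := by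
  intro W hW
  obtain ⟨hs, n, hn, hx⟩ := h₁ W hW
  obtain ⟨hs', m, hm, hy⟩ := h₂ _ hs
  refine ⟨hs'.mono (by omega), n + m, ?_, .seq hx hy⟩
  nlinarith

theorem Runs.iteTrue {b : Expr} {c₁ c₂ : Program} {s s' : Store} {A : ℕ} (hb : b.eval s ≠ 0)
    (h : Runs c₁ s s' A) : Runs (.ite b c₁ c₂) s s' (b.weight + 1 + A) := by
  intro W hW
  obtain ⟨hs, n, hn, hx⟩ := h W hW
  have := b.cost_le hW
  refine ⟨hs.mono (by omega), _, ?_, .iteTrue hb hx⟩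
  nlinarith

theorem Runs.iteFalse {b : Expr} {c₁ c₂ : Program} {s s' : Store} {A : ℕ} (hb : b.eval s = 0)
    (h : Runs c₂ s s' A) : Runs (.ite b c₁ c₂) s s' (b.weight + 1 + A) := by
  intro W hW
  obtain ⟨hs, n, hn, hx⟩ := h W hW
  have := b.cost_le hW
  refine ⟨hs.mono (by omega), _, ?_, .iteFalse hb hx⟩
  nlinarith

theorem Runs.loopFalse {b : Expr} {c : Program} {s : Store} (hb : b.eval s = 0) :
    Runs (.loop b c) s s (b.weight + 1) := by
  intro W hW
  have := b.cost_le hW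
  refine ⟨hW.mono (by omega), _, ?_, .loopFalse hb⟩
  nlinarith

theorem Runs.loopTrue {b : Expr} {c : Program} {s s' s'' : Store} {A B : ℕ} (hb : b.eval s ≠ 0)
    (h₁ : Runs c s s' A) (h₂ : Runs (.loop b c) s' s'' B) :
    Runs (.loop b c) s s'' (b.weight + 1 + A + B) := by
  intro W hW
  obtain ⟨hs, n, hn, hx⟩ := h₁ W hW
  obtain ⟨hs', m, hm, hy⟩ := h₂ _ hs
  have := b.cost_le hW
  refine ⟨hs'.mono (by omega), _, ?_, .loopTrue hb hx hy⟩
  nlinarith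

/-- A loop with an invariant `P i`, `i` being the number of rounds done, that makes `m` more rounds
of resources `A` each. -/
theorem Runs.loop {b : Expr} {c : Program} {A K : ℕ} (P : ℕ → Store → Prop)
    (hdone : ∀ s, P K s → b.eval s = 0)
    (hgo : ∀ i s, i < K → P i s → b.eval s ≠ 0 ∧ ∃ s', Runs c s s' A ∧ P (i + 1) s')
    (m i : ℕ) (hm : i + m = K) (s : Store) (hs : P i s) :
    ∃ s', Runs (.loop b c) s s' ((m + 1) * (b.weight + 1 + A)) ∧ P K s' := by
  induction m generalizing i s with
  | zero =>
    obtain rfl : i = K := by omega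
    exact ⟨s, (Runs.loopFalse (hdone s hs)).mono (by nlinarith), hs⟩
  | succ m ih =>
    obtain ⟨hb, s', hr, hP⟩ := hgo i s (by omega) hs
    obtain ⟨s'', hr', hP'⟩ := ih (i + 1) (by omega) s' hP
    exact ⟨s'', (Runs.loopTrue hb hr hr').mono (by nlinarith), hP'⟩

end RAM

/-! ### A calculus of functions that programs compute in polynomial time -/

namespace RAM

/-- A type of contexts in which programs run: a context determines the contents `raw` of the array
that holds the input, a number `bnd` that bounds the rounds of all loops, and the values of
`arity` many variables, which are held in registers. -/
class Env (Γ : Type) where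
  raw : Γ → ℕ → ℕ
  bnd : Γ → ℕ
  arity : ℕ
  var : Γ → ℕ → ℕ

open Env

variable {Γ : Type} [Env Γ]

/-- A context extended by one more variable. -/
instance : Env (Γ × ℕ) where
  raw p := raw p.1
  bnd p := bnd p.1
  arity := arity Γ + 1
  var p k := if k = arity Γ then p.2 else var p.1 k

/-- The store `s` represents the context `γ`: the input is in array `1`, the bound on loops in
register `1`, and variable `k` in register `ρ k`. -/
def Holds (ρ : ℕ → ℕ) (γ : Γ) (s : Store) : Prop :=
  s.arr 1 = raw γ ∧ s.reg 1 = bnd γ ∧ ∀ k < arity Γ, s.reg (ρ k) = var γ k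

/-- The function `F` of the context is computed with resources polynomial in the bound on loops.
The variables may sit in any registers below `d`; the result goes to register `d`, and everything
below is preserved.  The freedom in the placement of variables is what allows a subprogram to be
used in an extended context. -/
def Comp (F : Γ → ℕ) : Prop :=
  ∃ A : Polynomial ℕ, ∀ (ρ : ℕ → ℕ) (d : ℕ), 2 ≤ d → (∀ k < arity Γ, ρ k < d) →
    ∃ c : Program, ∀ (γ : Γ) (s : Store), Holds ρ γ s →
      ∃ s', Runs c s s' (A.eval (bnd γ)) ∧ s'.reg d = F γ ∧ (∀ x < d, s'.reg x = s.reg x) ∧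
        s'.arr = s.arr

theorem Holds.congr {ρ : ℕ → ℕ} {γ : Γ} {s s' : Store} {d : ℕ} (hd : 2 ≤ d)
    (hρ : ∀ k < arity Γ, ρ k < d) (h : Holds ρ γ s) (hr : ∀ x < d, s'.reg x = s.reg x)
    (ha : s'.arr = s.arr) : Holds ρ γ s' :=
  ⟨by rw [ha, h.1], by rw [hr 1 (by omega), h.2.1], fun k hk => by rw [hr _ (hρ k hk), h.2.2 k hk]⟩

namespace Comp

theorem weak {F : Γ → ℕ} (h : Comp F) : Comp fun p : Γ × ℕ => F p.1 := by
  obtain ⟨A, h⟩ := h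
  refine ⟨A, fun ρ d hd hρ => ?_⟩
  have hρ' : ∀ k < arity Γ, ρ k < d := fun k hk => hρ k (Nat.lt_succ_of_lt hk)
  obtain ⟨c, hc⟩ := h ρ d hd hρ'
  refine ⟨c, fun γ s hs => hc γ.1 s ⟨hs.1, hs.2.1, fun k hk => ?_⟩⟩
  rw [hs.2.2 k (Nat.lt_succ_of_lt hk)]
  exact if_neg hk.ne

theorem ofExpr {F : Γ → ℕ} {w : ℕ} (h : ∀ ρ : ℕ → ℕ, ∃ e : Expr, e.weight ≤ w ∧
    ∀ (γ : Γ) (s : Store), Holds ρ γ s → e.eval s = F γ) : Comp F := by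
  refine ⟨(w + 1 : ℕ), fun ρ d hd hρ => ?_⟩
  obtain ⟨e, hw, he⟩ := h ρ
  refine ⟨.assign d e, fun γ s hs => ⟨_, (Runs.assign s d e).mono ?_, ?_, fun x hx => ?_, rfl⟩⟩
  · simp only [Polynomial.eval_natCast, Nat.cast_id]; omega
  · simp [Store.setReg, he γ s hs]
  · simp [Store.setReg, hx.ne]

theorem lit (n : ℕ) : Comp fun _ : Γ => n :=
  ofExpr fun _ => ⟨.lit n, le_rfl, fun _ _ _ => rfl⟩

theorem bound : Comp fun γ : Γ => bnd γ :=
  ofExpr fun _ => ⟨.reg 1, le_rfl, fun _ _ hs => hs.2.1⟩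

/-- The innermost variable of a context. -/
theorem last : Comp fun p : Γ × ℕ => p.2 :=
  ofExpr fun ρ => ⟨.reg (ρ (arity Γ)), le_rfl, fun γ s hs => by
    simpa [Expr.eval, var] using hs.2.2 (arity Γ) (Nat.lt_succ_self _)⟩

/-- Composition with a single machine operation of one operand. -/
theorem unary {F G : Γ → ℕ} (op : Expr → Expr) (w : ℕ)
    (hw : ∀ d, (op (.reg d)).weight ≤ w)
    (hop : ∀ γ s d, s.arr 1 = raw γ → s.reg d = F γ → (op (.reg d)).eval s = G γ)
    (hF : Comp F) : Comp G := by
  obtain ⟨A, hA⟩ := hF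
  refine ⟨A + (w + 1 : ℕ), fun ρ d hd hρ => ?_⟩
  obtain ⟨c, hc⟩ := hA ρ d hd hρ
  refine ⟨.seq c (.assign d (op (.reg d))), fun γ s hs => ?_⟩
  obtain ⟨s₁, hr, hv, hp, ha⟩ := hc γ s hs
  refine ⟨_, (hr.seq (Runs.assign s₁ d _)).mono ?_, ?_, fun x hx => ?_, ha⟩
  · have := hw d
    simp only [Polynomial.eval_add, Polynomial.eval_natCast, Nat.cast_id]; omega
  · simp [Store.setReg, hop γ s₁ d (by rw [ha, hs.1]) hv]
  · simp [Store.setReg, hx.ne, hp x hx]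

/-- Composition with a single machine operation of two operands. -/
theorem binary {F G : Γ → ℕ} (op : Expr → Expr → Expr) (f : ℕ → ℕ → ℕ) (w : ℕ)
    (hw : ∀ d e, (op (.reg d) (.reg e)).weight ≤ w)
    (hop : ∀ s d e, (op (.reg d) (.reg e)).eval s = f (s.reg d) (s.reg e))
    (hF : Comp F) (hG : Comp G) : Comp fun γ => f (F γ) (G γ) := by
  obtain ⟨A, hA⟩ := hF
  obtain ⟨B, hB⟩ := hG
  refine ⟨A + B + (w + 1 : ℕ), fun ρ d hd hρ => ?_⟩
  have hρ' : ∀ k < arity Γ, ρ k < d + 1 := fun k hk => (hρ k hk).trans (Nat.lt_succ_self d)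
  obtain ⟨c, hc⟩ := hA ρ d hd hρ
  obtain ⟨c', hc'⟩ := hB ρ (d + 1) (by omega) hρ'
  refine ⟨.seq (.seq c c') (.assign d (op (.reg d) (.reg (d + 1)))), fun γ s hs => ?_⟩
  obtain ⟨s₁, hr, hv, hp, ha⟩ := hc γ s hs
  obtain ⟨s₂, hr', hv', hp', ha'⟩ := hc' γ s₁ (hs.congr hd hρ hp ha)
  refine ⟨_, ((hr.seq hr').seq (Runs.assign s₂ d _)).mono ?_, ?_, fun x hx => ?_, ha'.trans ha⟩
  · have := hw d (d + 1)
    simp only [Polynomial.eval_add, Polynomial.eval_natCast, Nat.cast_id]; omega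
  · simp [Store.setReg, hop, hv', hp' d (Nat.lt_succ_self d), hv]
  · simp [Store.setReg, hx.ne, hp x hx, hp' x (by omega)]

variable {F G : Γ → ℕ}

theorem get (h : Comp F) : Comp fun γ => raw γ (F γ) :=
  unary (fun e => .get 1 e) 2 (fun _ => le_rfl)
    (fun γ s d ha hv => by simp [Expr.eval, ha, hv]) h

theorem add (hF : Comp F) (hG : Comp G) : Comp fun γ => F γ + G γ :=
  binary .add (· + ·) 3 (fun _ _ => le_rfl) (fun _ _ _ => rfl) hF hG

theorem sub (hF : Comp F) (hG : Comp G) : Comp fun γ => F γ - G γ :=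
  binary .sub (· - ·) 3 (fun _ _ => le_rfl) (fun _ _ _ => rfl) hF hG

theorem lt (hF : Comp F) (hG : Comp G) : Comp fun γ => if F γ < G γ then 1 else 0 :=
  binary .lt (fun a b => if a < b then 1 else 0) 3 (fun _ _ => le_rfl) (fun _ _ _ => rfl) hF hG

theorem eq (hF : Comp F) (hG : Comp G) : Comp fun γ => if F γ = G γ then 1 else 0 :=
  binary .eq (fun a b => if a = b then 1 else 0) 3 (fun _ _ => le_rfl) (fun _ _ _ => rfl) hF hG

theorem of_eq (hF : Comp F) (h : ∀ γ, F γ = G γ) : Comp G := by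
  rwa [← funext h]

theorem select {C : Γ → ℕ} (hC : Comp C) (hF : Comp F) (hG : Comp G) :
    Comp fun γ => if C γ = 0 then G γ else F γ := by
  obtain ⟨D, hD⟩ := hC
  obtain ⟨A, hA⟩ := hF
  obtain ⟨B, hB⟩ := hG
  refine ⟨D + (2 + A + B), fun ρ d hd hρ => ?_⟩
  obtain ⟨c₀, hc₀⟩ := hD ρ d hd hρ
  obtain ⟨c₁, hc₁⟩ := hA ρ d hd hρ
  obtain ⟨c₂, hc₂⟩ := hB ρ d hd hρ
  refine ⟨.seq c₀ (.ite (.reg d) c₁ c₂), fun γ s hs => ?_⟩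
  obtain ⟨s₁, hr, hv, hp, ha⟩ := hc₀ γ s hs
  have hs₁ := hs.congr hd hρ hp ha
  by_cases h : C γ = 0
  · obtain ⟨s₂, hr', hv', hp', ha'⟩ := hc₂ γ s₁ hs₁
    refine ⟨s₂, (hr.seq (Runs.iteFalse (b := .reg d) (c₁ := c₁) (hv.trans h) hr')).mono ?_, ?_,
      fun x hx => ?_, ha'.trans ha⟩
    · simp only [Polynomial.eval_add, Polynomial.eval_ofNat, Expr.weight]; omega
    · simp [hv', h]
    · simp [hp x hx, hp' x hx]
  · obtain ⟨s₂, hr', hv', hp', ha'⟩ := hc₁ γ s₁ hs₁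
    refine ⟨s₂, (hr.seq (Runs.iteTrue (b := .reg d) (c₂ := c₂) (by rw [Expr.eval, hv]; exact h)
      hr')).mono ?_, ?_, fun x hx => ?_, ha'.trans ha⟩
    · simp only [Polynomial.eval_add, Polynomial.eval_ofNat, Expr.weight]; omega
    · simp [hv', h]
    · simp [hp x hx, hp' x hx]

theorem ite {p : Γ → Prop} [DecidablePred p] (hp : Comp fun γ => if p γ then 1 else 0)
    (hF : Comp F) (hG : Comp G) : Comp fun γ => if p γ then F γ else G γ :=
  (hp.select hF hG).of_eq fun γ => by by_cases h : p γ <;> simp [h]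

theorem iteLe {H K : Γ → ℕ} (hF : Comp F) (hG : Comp G) (hH : Comp H) (hK : Comp K) :
    Comp fun γ => if F γ ≤ G γ then H γ else K γ :=
  (ite (hG.lt hF) hK hH).of_eq fun γ => by split_ifs <;> first | rfl | omega

theorem min (hF : Comp F) (hG : Comp G) : Comp fun γ => min (F γ) (G γ) :=
  (ite (hF.lt hG) hF hG).of_eq fun γ => by split_ifs <;> omega

theorem max (hF : Comp F) (hG : Comp G) : Comp fun γ => max (F γ) (G γ) :=
  (ite (hF.lt hG) hG hF).of_eq fun γ => by split_ifs <;> omega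

/-- Iteration, once for every number below the bound on loops; the round counter and the
intermediate result are the two innermost variables of the context of the body. -/
theorem fold {f : Γ → ℕ → ℕ → ℕ} (hF : Comp F)
    (hf : Comp fun p : (Γ × ℕ) × ℕ => f p.1.1 p.1.2 p.2) :
    Comp fun γ => Nat.rec (F γ) (f γ) (bnd γ) := by
  obtain ⟨A, hA⟩ := hF
  obtain ⟨B, hB⟩ := hf
  refine ⟨A + 3 + (Polynomial.X + 1) * (4 + (B + 2 + 5)), fun ρ d hd hρ => ?_⟩
  obtain ⟨c, hc⟩ := hA ρ d hd hρ
  -- in the body, register `d + 1` counts the rounds and register `d` holds the result so far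
  set ρ' : ℕ → ℕ := fun k =>
    if k < arity Γ then ρ k else if k = arity Γ then d + 1 else d with hρ'def
  have hρ' : ∀ k < arity ((Γ × ℕ) × ℕ), ρ' k < d + 2 := by
    intro k _
    simp only [hρ'def]
    split_ifs with h₁ h₂
    · have := hρ k h₁; omega
    · omega
    · omega
  obtain ⟨c', hc'⟩ := hB ρ' (d + 2) (by omega) hρ'
  refine ⟨.seq (.seq c (.assign (d + 1) (.lit 0))) (.loop (.lt (.reg (d + 1)) (.reg 1))
    (.seq (.seq c' (.assign d (.reg (d + 2)))) (.assign (d + 1) (.add (.reg (d + 1)) (.lit 1))))),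
    fun γ s hs => ?_⟩
  obtain ⟨s₁, hr, hv, hp, ha⟩ := hc γ s hs
  have hr₁ := Runs.assign s₁ (d + 1) (.lit 0)
  set s₂ := s₁.setReg (d + 1) ((Expr.lit 0).eval s₁) with hs₂
  let P : ℕ → Store → Prop := fun i t => t.reg (d + 1) = i ∧
    t.reg d = Nat.rec (F γ) (f γ) i ∧ (∀ x < d, t.reg x = s.reg x) ∧
    t.arr = s.arr
  obtain ⟨s₃, hr₃, hP₃⟩ := Runs.loop (b := .lt (.reg (d + 1)) (.reg 1))
    (c := .seq (.seq c' (.assign d (.reg (d + 2))))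
      (.assign (d + 1) (.add (.reg (d + 1)) (.lit 1))))
    (A := B.eval (bnd γ) + 2 + 5) (K := bnd γ) P
    (fun t ht => by
      have h1 : t.reg 1 = bnd γ := by rw [ht.2.2.1 1 (by omega), hs.2.1]
      simp [Expr.eval, h1, ht.1])
    (fun i t hi ht => by
      obtain ⟨h₁, h₂, h₃, h₄⟩ := ht
      have h1 : t.reg 1 = bnd γ := by rw [h₃ 1 (by omega), hs.2.1]
      refine ⟨by simp [Expr.eval, h1, h₁, hi], ?_⟩
      have hh : Holds ρ' (((γ, i), t.reg d) : (Γ × ℕ) × ℕ) t := by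
        refine ⟨by rw [h₄, hs.1]; rfl, h1, fun k hk => ?_⟩
        change k < arity Γ + 1 + 1 at hk
        change t.reg (ρ' k) = if k = arity Γ + 1 then t.reg d else
          if k = arity Γ then i else var γ k
        simp only [hρ'def]
        rcases lt_trichotomy k (arity Γ) with h | h | h
        · rw [if_pos h, if_neg (by omega), if_neg (by omega), h₃ _ (hρ k h), hs.2.2 k h]
        · rw [if_neg (by omega), if_pos h, if_neg (by omega), if_pos h, h₁]
        · rw [if_neg (by omega), if_neg (by omega), if_pos (by omega)]
      obtain ⟨t', hr', hv', hp', ha'⟩ := hc' _ t hh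
      refine ⟨_, ((hr'.seq (Runs.assign _ d (.reg (d + 2)))).seq
        (Runs.assign _ (d + 1) (.add (.reg (d + 1)) (.lit 1)))).mono ?_, ?_, ?_, ?_, ?_⟩
      · simp only [Expr.weight, Nat.size_one]; exact le_rfl
      · simp [Store.setReg, Expr.eval, hp' (d + 1) (by omega), h₁]
      · simp [Store.setReg, Expr.eval, hv', h₂]
      · intro x hx
        simp only [Store.setReg, Expr.eval]
        rw [Function.update_of_ne (by omega), Function.update_of_ne (by omega), hp' x (by omega),
          h₃ x hx]
      · simp only [Store.setReg]; rw [ha', h₄])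
    (bnd γ) 0 (by omega) s₂ (by
      refine ⟨by simp [hs₂, Store.setReg, Expr.eval], by simp [hs₂, Store.setReg, hv], ?_, ha⟩
      intro x hx
      simp only [hs₂, Store.setReg]
      rw [Function.update_of_ne (by omega), hp x hx])
  refine ⟨s₃, ((hr.seq hr₁).seq hr₃).mono ?_, hP₃.2.1, hP₃.2.2⟩
  simp only [Polynomial.eval_add, Polynomial.eval_mul, Polynomial.eval_ofNat, Polynomial.eval_one,
    Polynomial.eval_X, Expr.weight, Nat.size_zero]
  nlinarith

theorem sum {f : Γ → ℕ → ℕ} (hf : Comp fun p : Γ × ℕ => f p.1 p.2) :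
    Comp fun γ => ∑ i ∈ Finset.range (bnd γ), f γ i :=
  (fold (f := fun γ i acc => acc + f γ i) (lit 0) (last.add hf.weak)).of_eq fun γ => by
    induction bnd γ with
    | zero => simp
    | succ n ih => rw [Finset.sum_range_succ, ← ih]

theorem sup {f : Γ → ℕ → ℕ} (hf : Comp fun p : Γ × ℕ => f p.1 p.2) :
    Comp fun γ => (Finset.range (bnd γ)).sup (f γ) :=
  (fold (f := fun γ i acc => Max.max acc (f γ i)) (lit 0) (last.max hf.weak)).of_eq fun γ => by
    induction bnd γ with
    | zero => simp
    | succ n ih => rw [Finset.range_add_one, Finset.sup_insert, ← ih, sup_comm]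

end Comp

/-- The list `F` of the context is computed with resources polynomial in the bound on loops, and
appended to the output. -/
def Emits (F : Γ → List ℕ) : Prop :=
  ∃ A : Polynomial ℕ, ∀ (ρ : ℕ → ℕ) (d : ℕ), 2 ≤ d → (∀ k < arity Γ, ρ k < d ∧ ρ k ≠ 0) →
    ∃ c : Program, ∀ (γ : Γ) (s : Store), Holds ρ γ s →
      ∃ s', Runs c s s' (A.eval (bnd γ)) ∧ s'.output = s.output ++ F γ ∧
        (∀ x < d, x ≠ 0 → s'.reg x = s.reg x) ∧ s'.arr 1 = s.arr 1

namespace Emits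

theorem single {F : Γ → ℕ} (hF : Comp F) : Emits fun γ => [F γ] := by
  obtain ⟨A, hA⟩ := hF
  refine ⟨A + 3 + 5, fun ρ d hd hρ => ?_⟩
  obtain ⟨c, hc⟩ := hA ρ d hd fun k hk => (hρ k hk).1
  refine ⟨.seq (.seq c (.put 0 (.reg 0) (.reg d))) (.assign 0 (.add (.reg 0) (.lit 1))),
    fun γ s hs => ?_⟩
  obtain ⟨s₁, hr, hv, hp, ha⟩ := hc γ s hs
  refine ⟨_, ((hr.seq (Runs.put _ _ _ _)).seq (Runs.assign _ _ _)).mono ?_, ?_, ?_, ?_⟩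
  · simp only [Polynomial.eval_add, Polynomial.eval_ofNat, Expr.weight, Nat.size_one]
    exact le_rfl
  · simp only [Store.output, Store.setReg, Store.setArr, Expr.eval, Function.update_self, hv,
      List.range_succ, List.map_append, hp 0 (by omega), ha, List.map_cons, List.map_nil]
    congr 1
    refine List.map_congr_left fun i hi => ?_
    rw [Function.update_of_ne (List.mem_range.1 hi).ne]
  · intro x hx h0
    simp only [Store.setReg, Store.setArr]
    rw [Function.update_of_ne h0, hp x hx]
  · simp only [Store.setReg, Store.setArr]
    rw [Function.update_of_ne one_ne_zero, ha]

theorem append {F G : Γ → List ℕ} (hF : Emits F) (hG : Emits G) :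
    Emits fun γ => F γ ++ G γ := by
  obtain ⟨A, hA⟩ := hF
  obtain ⟨B, hB⟩ := hG
  refine ⟨A + B, fun ρ d hd hρ => ?_⟩
  obtain ⟨c, hc⟩ := hA ρ d hd hρ
  obtain ⟨c', hc'⟩ := hB ρ d hd hρ
  refine ⟨.seq c c', fun γ s hs => ?_⟩
  obtain ⟨s₁, hr, ho, hp, ha⟩ := hc γ s hs
  have hs₁ : Holds ρ γ s₁ := ⟨ha.trans hs.1, (hp 1 (by omega) one_ne_zero).trans hs.2.1,
    fun k hk => (hp _ (hρ k hk).1 (hρ k hk).2).trans (hs.2.2 k hk)⟩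
  obtain ⟨s₂, hr', ho', hp', ha'⟩ := hc' γ s₁ hs₁
  refine ⟨s₂, (hr.seq hr').mono (by simp), by rw [ho', ho, List.append_assoc], ?_, ha'.trans ha⟩
  intro x hx h0
  rw [hp' x hx h0, hp x hx h0]

/-- Emission in a loop over the numbers below the bound on loops. -/
theorem flatMap {f : Γ → ℕ → List ℕ} (hf : Emits fun p : Γ × ℕ => f p.1 p.2) :
    Emits fun γ => (List.range (bnd γ)).flatMap (f γ) := by
  obtain ⟨B, hB⟩ := hf
  refine ⟨2 + (Polynomial.X + 1) * (4 + (B + 5)), fun ρ d hd hρ => ?_⟩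
  set ρ' : ℕ → ℕ := fun k => if k < arity Γ then ρ k else d with hρ'def
  have hρ' : ∀ k < arity (Γ × ℕ), ρ' k < d + 1 ∧ ρ' k ≠ 0 := by
    intro k _
    simp only [hρ'def]
    split_ifs with h₁
    · have := hρ k h₁; omega
    · omega
  obtain ⟨c', hc'⟩ := hB ρ' (d + 1) (by omega) hρ'
  refine ⟨.seq (.assign d (.lit 0)) (.loop (.lt (.reg d) (.reg 1))
    (.seq c' (.assign d (.add (.reg d) (.lit 1))))), fun γ s hs => ?_⟩
  have hr₁ := Runs.assign s d (.lit 0)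
  set s₂ := s.setReg d ((Expr.lit 0).eval s) with hs₂
  let P : ℕ → Store → Prop := fun i t => t.reg d = i ∧
    t.output = s.output ++ (List.range i).flatMap (f γ) ∧
    (∀ x < d, x ≠ 0 → t.reg x = s.reg x) ∧ t.arr 1 = s.arr 1
  obtain ⟨s₃, hr₃, hP₃⟩ := Runs.loop (b := .lt (.reg d) (.reg 1))
    (c := .seq c' (.assign d (.add (.reg d) (.lit 1))))
    (A := B.eval (bnd γ) + 5) (K := bnd γ) P
    (fun t ht => by
      have h1 : t.reg 1 = bnd γ := by rw [ht.2.2.1 1 (by omega) one_ne_zero, hs.2.1]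
      simp [Expr.eval, h1, ht.1])
    (fun i t hi ht => by
      obtain ⟨h₁, h₂, h₃, h₄⟩ := ht
      have h1 : t.reg 1 = bnd γ := by rw [h₃ 1 (by omega) one_ne_zero, hs.2.1]
      refine ⟨by simp [Expr.eval, h1, h₁, hi], ?_⟩
      have hh : Holds ρ' ((γ, i) : Γ × ℕ) t := by
        refine ⟨by rw [h₄, hs.1]; rfl, h1, fun k hk => ?_⟩
        change k < arity Γ + 1 at hk
        change t.reg (ρ' k) = if k = arity Γ then i else var γ k
        simp only [hρ'def]
        rcases Nat.lt_or_ge k (arity Γ) with h | h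
        · rw [if_pos h, if_neg (by omega), h₃ _ (hρ k h).1 (hρ k h).2, hs.2.2 k h]
        · rw [if_neg (by omega), if_pos (by omega), h₁]
      obtain ⟨t', hr', ho', hp', ha'⟩ := hc' _ t hh
      refine ⟨_, (hr'.seq (Runs.assign _ d (.add (.reg d) (.lit 1)))).mono ?_, ?_, ?_, ?_, ?_⟩
      · simp only [Expr.weight, Nat.size_one]; exact le_rfl
      · simp [Store.setReg, Expr.eval, hp' d (by omega) (by omega), h₁]
      · have : (t'.setReg d ((Expr.add (.reg d) (.lit 1)).eval t')).output = t'.output := by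
          simp only [Store.output, Store.setReg]
          rw [Function.update_of_ne (by omega)]
        rw [this, ho', h₂, List.range_succ, List.flatMap_append, List.append_assoc]
        simp
      · intro x hx h0
        simp only [Store.setReg, Expr.eval]
        rw [Function.update_of_ne (by omega), hp' x (by omega) h0, h₃ x hx h0]
      · simp only [Store.setReg]; rw [ha', h₄])
    (bnd γ) 0 (by omega) s₂ (by
      refine ⟨by simp [hs₂, Store.setReg, Expr.eval], ?_, ?_, rfl⟩
      · simp only [hs₂, Store.output, Store.setReg, List.range_zero, List.flatMap_nil,
          List.append_nil]
        rw [Function.update_of_ne (by omega)]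
      · intro x hx _
        simp only [hs₂, Store.setReg]
        rw [Function.update_of_ne (by omega)])
  refine ⟨s₃, (hr₁.seq hr₃).mono ?_, hP₃.2.1, hP₃.2.2⟩
  simp only [Polynomial.eval_add, Polynomial.eval_mul, Polynomial.eval_ofNat, Polynomial.eval_one,
    Polynomial.eval_X, Expr.weight, Nat.size_zero]
  nlinarith

end Emits

end RAM

/-! ### From the calculus to programs on inputs -/

namespace RAM

/-- The context in which a program starts: the input, and the bound on loops. -/
structure Input where
  raw : ℕ → ℕ
  bnd : ℕ

instance : Env Input where
  raw := Input.raw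
  bnd := Input.bnd
  arity := 0
  var _ _ := 0

/-- The context belonging to a list of numbers.  The bound on loops is the length of
the list plus the bit length of its head, hence at most twice the size of the input. -/
def Input.ofList (inp : List ℕ) : Input where
  raw i := inp.getD i 0
  bnd := inp.length + (inp.getD 0 0).size

theorem length_le_bitSize (inp : List ℕ) : inp.length ≤ bitSize inp := by
  induction inp with
  | nil => simp
  | cons a t ih => simp only [bitSize, List.map_cons, List.sum_cons, List.length_cons] at *; omega

theorem size_getD_le_bitSize (inp : List ℕ) (i : ℕ) : (inp.getD i 0).size ≤ bitSize inp := by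
  induction inp generalizing i with
  | nil => simp
  | cons a t ih =>
    simp only [bitSize, List.map_cons, List.sum_cons] at *
    cases i with
    | zero => simp; omega
    | succ i => rw [List.getD_cons_succ]; exact (ih i).trans (by omega)

theorem size_le_self (n : ℕ) : n.size ≤ n :=
  Nat.size_le.2 Nat.lt_two_pow_self

theorem sizeLe_inputStore (inp : List ℕ) : (inputStore inp).SizeLe (bitSize inp) := by
  constructor
  · intro x
    simp only [inputStore]
    split_ifs
    · exact (size_le_self _).trans (length_le_bitSize inp)
    · simp
  · intro a i
    simp only [inputStore]
    split_ifs
    · exact size_getD_le_bitSize inp i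
    · simp

/-- Computes the bound on loops into register `1`, copies the input to array `1`, and empties the
output. -/
def prologue : Program :=
  .seq (.seq (.seq (.seq (.seq (.assign 1 (.reg 0)) (.assign 2 (.lit 1)))
    (.loop (.lt (.reg 2) (.add (.get 0 (.lit 0)) (.lit 1)))
      (.seq (.assign 2 (.add (.reg 2) (.reg 2))) (.assign 1 (.add (.reg 1) (.lit 1))))))
    (.assign 3 (.lit 0)))
    (.loop (.lt (.reg 3) (.reg 1))
      (.seq (.put 1 (.reg 3) (.get 0 (.reg 3))) (.assign 3 (.add (.reg 3) (.lit 1))))))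
    (.assign 0 (.lit 0))

theorem runs_prologue (inp : List ℕ) : ∃ s, Runs prologue (inputStore inp) s
      (50 * ((Input.ofList inp).bnd + 1)) ∧
    s.reg 0 = 0 ∧ s.reg 1 = (Input.ofList inp).bnd ∧ s.arr 1 = (Input.ofList inp).raw := by
  set N := inp.getD 0 0 with hN
  have h₁ := Runs.assign (inputStore inp) 1 (.reg 0)
  set s₁ := (inputStore inp).setReg 1 ((Expr.reg 0).eval (inputStore inp)) with hs₁
  have h₂ := Runs.assign s₁ 2 (.lit 1)
  set s₂ := s₁.setReg 2 ((Expr.lit 1).eval s₁) with hs₂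
  obtain ⟨s₃, h₃, hP₃⟩ := Runs.loop (b := .lt (.reg 2) (.add (.get 0 (.lit 0)) (.lit 1)))
    (c := .seq (.assign 2 (.add (.reg 2) (.reg 2))) (.assign 1 (.add (.reg 1) (.lit 1))))
    (A := 9) (K := N.size)
    (fun i t => t.reg 2 = 2 ^ i ∧ t.reg 1 = inp.length + i ∧ t.arr = (inputStore inp).arr)
    (fun t ht => by
      have := Nat.lt_size_self N
      simp only [Expr.eval, ht.1, ht.2.2, inputStore, if_true, ← hN]
      rw [if_neg (by omega)])
    (fun i t hi ht => by
      have := Nat.lt_size.1 hi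
      refine ⟨?_, _, ((Runs.assign _ 2 (.add (.reg 2) (.reg 2))).seq
        (Runs.assign _ 1 (.add (.reg 1) (.lit 1)))).mono ?_, ?_, ?_, ?_⟩
      · simp only [Expr.eval, ht.1, ht.2.2, inputStore, if_true, ← hN]
        rw [if_pos (by omega)]
        exact one_ne_zero
      · simp [Expr.weight]
      · simp [Store.setReg, Expr.eval, ht.1, pow_succ]; ring
      · simp [Store.setReg, Expr.eval, ht.2.1, add_assoc]
      · simpa [Store.setReg] using ht.2.2)
    N.size 0 (by omega) s₂ (by
      refine ⟨?_, ?_, rfl⟩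
      · simp [hs₂, Store.setReg, Expr.eval]
      · simp [hs₂, hs₁, Store.setReg, Expr.eval, inputStore])
  have h₄ := Runs.assign s₃ 3 (.lit 0)
  set s₄ := s₃.setReg 3 ((Expr.lit 0).eval s₃) with hs₄
  set M := inp.length + N.size with hM
  obtain ⟨s₅, h₅, hP₅⟩ := Runs.loop (b := .lt (.reg 3) (.reg 1))
    (c := .seq (.put 1 (.reg 3) (.get 0 (.reg 3))) (.assign 3 (.add (.reg 3) (.lit 1))))
    (A := 9) (K := M)
    (fun i t => t.reg 3 = i ∧ t.reg 1 = M ∧ t.arr 0 = (inputStore inp).arr 0 ∧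
      ∀ j, t.arr 1 j = if j < i then inp.getD j 0 else 0)
    (fun t ht => by simp [Expr.eval, ht.1, ht.2.1])
    (fun i t hi ht => by
      refine ⟨by simp [Expr.eval, ht.1, ht.2.1, hi], _, ((Runs.put _ 1 (.reg 3) (.get 0 (.reg 3))).seq
        (Runs.assign _ 3 (.add (.reg 3) (.lit 1)))).mono ?_, ?_, ?_, ?_, ?_⟩
      · simp [Expr.weight]
      · simp [Store.setReg, Store.setArr, Expr.eval, ht.1]
      · simp [Store.setReg, Store.setArr, Expr.eval, ht.2.1]
      · simpa [Store.setReg, Store.setArr] using ht.2.2.1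
      · intro j
        simp only [Store.setReg, Store.setArr, Expr.eval, ht.1, ht.2.2.1, Function.update_self,
          Function.update_apply, ht.2.2.2]
        by_cases hj : j = i
        · rw [if_pos hj, if_pos (by omega), hj]; rfl
        · rw [if_neg hj]
          by_cases hji : j < i
          · rw [if_pos hji, if_pos (by omega)]
          · rw [if_neg hji, if_neg (by omega)])
    M 0 (by omega) s₄ (by
      refine ⟨?_, ?_, ?_, ?_⟩
      · simp [hs₄, Store.setReg, Expr.eval]
      · simp [hs₄, Store.setReg, hP₃.2.1, hM]
      · simp [hs₄, Store.setReg, hP₃.2.2]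
      · simp [hs₄, Store.setReg, hP₃.2.2, inputStore])
  refine ⟨_, (((((h₁.seq h₂).seq h₃).seq h₄).seq h₅).seq (Runs.assign s₅ 0 (.lit 0))).mono ?_,
    ?_, ?_, ?_⟩
  · simp only [Expr.weight, Nat.size_zero, Nat.size_one, Input.ofList, ← hN]
    omega
  · simp [Store.setReg, Expr.eval]
  · simp only [Store.setReg]
    rw [Function.update_of_ne one_ne_zero, hP₅.2.1]
    rfl
  · funext j
    simp only [Store.setReg, hP₅.2.2.2, Input.ofList]
    split_ifs with h
    · rfl
    · rw [List.getD_eq_default _ _ (by omega)]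

theorem eval_mono_nat (p : Polynomial ℕ) {a b : ℕ} (h : a ≤ b) : p.eval a ≤ p.eval b := by
  rw [Polynomial.eval_eq_sum, Polynomial.eval_eq_sum]
  exact Finset.sum_le_sum fun i _ => Nat.mul_le_mul_left _ (Nat.pow_le_pow_left h i)

/-- What the calculus emits is the output of a polynomial-time program. -/
theorem Emits.exists_program {F : Input → List ℕ} (hF : Emits F) :
    ∃ (c : Program) (q : Polynomial ℕ), ∀ inp : List ℕ,
      c.OutputsWithin inp (F (Input.ofList inp)) (q.eval (bitSize inp)) := by
  obtain ⟨A, hA⟩ := hF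
  obtain ⟨c, hc⟩ := hA id 2 le_rfl fun k hk => absurd hk (Nat.not_lt_zero k)
  set B : Polynomial ℕ := (50 * (Polynomial.X + 1) + A).comp (2 * Polynomial.X) with hB
  refine ⟨.seq prologue c, B * (Polynomial.X + B), fun inp => ?_⟩
  obtain ⟨s, hr, h0, h1, ha⟩ := runs_prologue inp
  obtain ⟨s', hr', ho, -⟩ := hc (Input.ofList inp) s
    ⟨ha, h1, fun k hk => absurd hk (Nat.not_lt_zero k)⟩
  obtain ⟨-, n, hn, hx⟩ := (hr.seq hr') _ (sizeLe_inputStore inp)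
  refine ⟨s', n, hx, by rw [ho]; simp [Store.output, h0], hn.trans ?_⟩
  have hle : (Input.ofList inp).bnd ≤ 2 * bitSize inp := by
    have := length_le_bitSize inp
    have := size_getD_le_bitSize inp 0
    simp only [Input.ofList]
    omega
  have hBe : 50 * ((Input.ofList inp).bnd + 1) + A.eval (Env.bnd (Input.ofList inp)) ≤
      B.eval (bitSize inp) := by
    have := eval_mono_nat (50 * (Polynomial.X + 1) + A) hle
    simp only [hB, Polynomial.eval_comp, Polynomial.eval_add, Polynomial.eval_mul,
      Polynomial.eval_ofNat, Polynomial.eval_X, Polynomial.eval_one] at this ⊢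
    exact this
  simp only [Polynomial.eval_mul, Polynomial.eval_add, Polynomial.eval_X]
  gcongr

end RAM

/-! ### Feasibility of preemptive schedules -/

namespace PSBA

/-- If the jobs whose intervals lie in an interval of slots never need more slots than it has, then
the same holds for all finite sets of slots: every job interval lies in one run of the set. -/
theorem sum_le_card_of_interval_bound {ι : Type*} [Fintype ι] (a b p : ι → ℕ)
    (h : ∀ x y, ∑ i with x ≤ a i ∧ b i ≤ y, p i ≤ y + 1 - x) (X : Finset ℕ) :
    ∑ i with Finset.Icc (a i) (b i) ⊆ X, p i ≤ X.card := by
  classical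
  have hempty : ∀ i, b i < a i → p i = 0 := by
    intro i hi
    have h₁ := h (a i) (b i)
    have h₂ : p i ≤ ∑ j with a i ≤ a j ∧ b j ≤ b i, p j :=
      Finset.single_le_sum (f := p) (fun _ _ => Nat.zero_le _) (by simp)
    omega
  induction X using Finset.strongInduction with
  | H X ih =>
  rcases X.eq_empty_or_nonempty with rfl | hX
  · refine (Finset.sum_eq_zero fun i hi => hempty i ?_).le
    simpa [Finset.subset_empty, Finset.Icc_eq_empty_iff] using hi
  set m := X.min' hX with hm
  have hmX : m ∈ X := X.min'_mem hX
  -- `e` is the end of the run of `X` that starts at its least element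
  have hex : ∃ k, m + k + 1 ∉ X := by
    by_contra! hall
    have := X.le_max' _ (hall (X.max' hX))
    omega
  set e := m + Nat.find hex with he
  have hrun : Finset.Icc m e ⊆ X := by
    intro t ht
    rw [Finset.mem_Icc] at ht
    rcases Nat.eq_or_lt_of_le ht.1 with h' | h'
    · exact h' ▸ hmX
    · have := Nat.find_min hex (m := t - m - 1) (by omega)
      rw [not_not] at this
      convert this using 1
      omega
  have hend : e + 1 ∉ X := Nat.find_spec hex
  have hlt : X \ Finset.Icc m e ⊂ X := by
    refine Finset.sdiff_ssubset hrun ⟨m, ?_⟩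
    rw [Finset.mem_Icc]; omega
  have hsplit : ∑ i with Finset.Icc (a i) (b i) ⊆ X, p i ≤
      ∑ i with m ≤ a i ∧ b i ≤ e, p i +
        ∑ i with Finset.Icc (a i) (b i) ⊆ X \ Finset.Icc m e, p i := by
    simp only [Finset.sum_filter]
    rw [← Finset.sum_add_distrib]
    refine Finset.sum_le_sum fun i _ => ?_
    by_cases hab : b i < a i
    · simp [hempty i hab]
    by_cases hi : Finset.Icc (a i) (b i) ⊆ X
    · rw [if_pos hi]
      have hma : m ≤ a i := X.min'_le _ (hi (Finset.mem_Icc.2 ⟨le_rfl, by omega⟩))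
      by_cases hae : a i ≤ e
      · have : b i ≤ e := by
          by_contra hbe
          exact hend (hi (Finset.mem_Icc.2 ⟨by omega, by omega⟩))
        rw [if_pos ⟨hma, this⟩]
        omega
      · have : Finset.Icc (a i) (b i) ⊆ X \ Finset.Icc m e := by
          intro t ht
          refine Finset.mem_sdiff.2 ⟨hi ht, ?_⟩
          rw [Finset.mem_Icc] at ht ⊢
          omega
        rw [if_pos this]
        omega
    · rw [if_neg hi]
      omega
  have hcard := Finset.card_sdiff_add_card_eq_card hrun
  rw [Nat.card_Icc] at hcard
  have h₁ := h m e
  have h₂ := ih _ hlt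
  omega

/-- The interval criterion for feasibility, by Hall's marriage theorem for units of jobs and
slots. -/
theorem exists_schedule_of_interval_bound {ι : Type*} [Fintype ι] [DecidableEq ι] (a b p : ι → ℕ)
    (h : ∀ x y, ∑ i with x ≤ a i ∧ b i ≤ y, p i ≤ y + 1 - x) :
    ∃ s : ℕ → Option ι, (∀ t i, s t = some i → a i ≤ t ∧ t ≤ b i) ∧
      ∀ i, ∃ S : Finset ℕ, S.card = p i ∧ ∀ t, t ∈ S ↔ s t = some i := by
  classical
  obtain ⟨f, hf, hfr⟩ := (Finset.all_card_le_biUnion_card_iff_exists_injective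
    fun x : Σ i, Fin (p i) => Finset.Icc (a x.1) (b x.1)).1 (by
      intro A
      set X := A.biUnion fun x => Finset.Icc (a x.1) (b x.1) with hX
      refine le_trans ?_ (sum_le_card_of_interval_bound a b p h X)
      have hsub : A ⊆ (Finset.univ.filter fun i => Finset.Icc (a i) (b i) ⊆ X).sigma
          fun i => (Finset.univ : Finset (Fin (p i))) := by
        intro x hx
        rw [Finset.mem_sigma, Finset.mem_filter]
        exact ⟨⟨Finset.mem_univ _, Finset.subset_biUnion_of_mem
          (fun x : Σ i, Fin (p i) => Finset.Icc (a x.1) (b x.1)) hx⟩, Finset.mem_univ _⟩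
      simpa [Finset.card_sigma] using Finset.card_le_card hsub)
  refine ⟨fun t => if ht : ∃ x, f x = t then some ht.choose.1 else none, ?_, fun i => ?_⟩
  · intro t i ht
    dsimp only at ht
    split_ifs at ht with hx
    obtain rfl := Option.some.inj ht
    have := hfr hx.choose
    rw [hx.choose_spec] at this
    exact Finset.mem_Icc.1 this
  · refine ⟨Finset.univ.image fun k : Fin (p i) => f ⟨i, k⟩, ?_, fun t => ?_⟩
    · rw [Finset.card_image_of_injective, Finset.card_univ, Fintype.card_fin]
      intro k k' hk
      simpa using hf hk
    · simp only [Finset.mem_image, Finset.mem_univ, true_and]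
      constructor
      · rintro ⟨k, rfl⟩
        have hx : ∃ x, f x = f ⟨i, k⟩ := ⟨_, rfl⟩
        rw [dif_pos hx, hf hx.choose_spec]
      · intro ht
        split_ifs at ht with hx
        obtain rfl := Option.some.inj ht
        exact ⟨hx.choose.2, hx.choose_spec⟩

/-- In a feasible schedule, the jobs that must be processed within the slots `I` leave at most
`|I|` minus their total processing time of these slots idle. -/
theorem JobSchedule.Feasible.idle_add_le {J : List Job} {s : JobSchedule J} {N : ℕ}
    (hs : s.Feasible N) (I : Finset ℕ) (K : Finset (Fin J.length))
    (hK : ∀ j ∈ K, Finset.Icc (J.get j).release (min (J.get j).deadline N) ⊆ I) :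
    (I.filter fun t => s t = none).card + ∑ j ∈ K, (J.get j).processing ≤ I.card := by
  classical
  have hbusy : ∑ j ∈ K, (J.get j).processing ≤ (I.filter fun t => s t ≠ none).card := by
    have hsum : ∑ j ∈ K, (J.get j).processing =
        (K.biUnion fun j => (timeline N).filter fun t => s t = some j).card := by
      rw [Finset.card_biUnion]
      · exact Finset.sum_congr rfl fun j _ => (hs.2 j).symm
      · intro i _ j _ hij
        refine Finset.disjoint_left.2 fun t ht ht' => hij ?_
        rw [Finset.mem_filter] at ht ht'
        exact Option.some.inj (ht.2.symm.trans ht'.2)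
    rw [hsum]
    refine Finset.card_le_card fun t ht => ?_
    obtain ⟨j, hj, ht⟩ := Finset.mem_biUnion.1 ht
    obtain ⟨htl, hst⟩ := Finset.mem_filter.1 ht
    obtain ⟨-, hr, hd⟩ := hs.1 t j hst
    refine Finset.mem_filter.2 ⟨hK j hj (Finset.mem_Icc.2 ⟨hr, le_min hd ?_⟩), by simp [hst]⟩
    exact (Finset.mem_Icc.1 htl).2
  have := Finset.card_filter_add_card_filter_not (s := I) (fun t => s t = none)
  simp only [ne_eq] at hbusy
  omega

theorem bddAbove_agreements (N : ℕ) (J : List Job) (S : Finset ℕ) :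
    BddAbove {a | ∃ s : JobSchedule J, s.Feasible N ∧ s.agreement S = a} := by
  refine ⟨S.card, ?_⟩
  rintro a ⟨s, -, rfl⟩
  exact Finset.card_filter_le _ _

theorem agreement_le_agr {N : ℕ} {J : List Job} {s : JobSchedule J} (hs : s.Feasible N)
    (S : Finset ℕ) : s.agreement S ≤ agr N J S :=
  le_csSup (bddAbove_agreements N J S) ⟨s, hs, rfl⟩

theorem exists_agreement_eq_agr {N : ℕ} {J : List Job} (h : ∃ s : JobSchedule J, s.Feasible N)
    (S : Finset ℕ) : ∃ s : JobSchedule J, s.Feasible N ∧ s.agreement S = agr N J S := by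
  obtain ⟨s, hs⟩ := h
  have hne : {a | ∃ s : JobSchedule J, s.Feasible N ∧ s.agreement S = a}.Nonempty :=
    ⟨_, s, hs, rfl⟩
  exact Nat.sSup_mem hne (bddAbove_agreements N J S)

theorem agr_mono {N : ℕ} {J : List Job} (h : ∃ s : JobSchedule J, s.Feasible N) {S S' : Finset ℕ}
    (hS : S ⊆ S') : agr N J S ≤ agr N J S' := by
  obtain ⟨s, hs, he⟩ := exists_agreement_eq_agr h S
  rw [← he]
  exact (Finset.card_le_card (Finset.filter_subset_filter _ hS)).trans (agreement_le_agr hs S')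

/-- An event that wants `D` agreement slots is one more job, with processing time `D`: agreement
`D` can be reached if jobs and event together satisfy the interval criterion. -/
theorem le_agr_of_interval_bound {N : ℕ} {J : List Job} (hJ : ∀ j ∈ J, j.Valid) {t e D : ℕ}
    (h : ∀ x y, ∑ j with x ≤ (J.get j).release ∧ min (J.get j).deadline N ≤ y,
      (J.get j).processing ≤ y + 1 - x)
    (hD : ∀ x y, x ≤ t → e ≤ y →
      D + ∑ j with x ≤ (J.get j).release ∧ min (J.get j).deadline N ≤ y,
        (J.get j).processing ≤ y + 1 - x) :
    D ≤ agr N J (Finset.Icc t e) := by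
  classical
  obtain ⟨s, hs, hc⟩ := exists_schedule_of_interval_bound (ι := Option (Fin J.length))
    (fun o => o.elim t fun j => (J.get j).release)
    (fun o => o.elim e fun j => min (J.get j).deadline N)
    (fun o => o.elim D fun j => (J.get j).processing) (by
      intro x y
      rw [Finset.sum_filter, Fintype.sum_option]
      simp only [Option.elim_none, Option.elim_some]
      have h₁ := h x y
      have h₂ := hD x y
      rw [Finset.sum_filter] at h₁ h₂
      by_cases hxy : x ≤ t ∧ e ≤ y
      · exact (congrArg (· + _) (if_pos hxy)).trans_le (h₂ hxy.1 hxy.2)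
      · exact ((congrArg (· + _) (if_neg hxy)).trans (zero_add _)).trans_le h₁)
  have hjoin : ∀ u j, (s u).join = some j ↔ s u = some (some j) := fun u j => Option.join_eq_some_iff
  have hfeas : JobSchedule.Feasible (J := J) (fun u => (s u).join) N := by
    have hin : ∀ u j, (s u).join = some j →
        u ∈ timeline N ∧ (J.get j).release ≤ u ∧ u ≤ (J.get j).deadline := by
      intro u j hu
      have h₁ := hs u _ ((hjoin u j).1 hu)
      simp only [Option.elim_some] at h₁
      have h₂ := (hJ _ (J.get_mem j)).1
      refine ⟨Finset.mem_Icc.2 ⟨by omega, by omega⟩, h₁.1, by omega⟩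
    refine ⟨hin, fun j => ?_⟩
    obtain ⟨S, hS, hmem⟩ := hc (some j)
    simp only [Option.elim_some] at hS
    rw [← hS]
    congr 1
    ext u
    rw [Finset.mem_filter, hmem, hjoin]
    exact ⟨fun h => h.2, fun h => ⟨(hin u j ((hjoin u j).2 h)).1, h⟩⟩
  refine le_trans ?_ (agreement_le_agr hfeas _)
  obtain ⟨S, hS, hmem⟩ := hc none
  simp only [Option.elim_none] at hS
  rw [← hS]
  refine Finset.card_le_card fun u hu => ?_
  have hu := (hmem u).1 hu
  refine Finset.mem_filter.2 ⟨Finset.mem_Icc.2 (hs u _ hu), by simp [hu]⟩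

end PSBA

/-! ### A closed formula for the agreement function -/

namespace PSBA

/-- The least of `c` and of the values `f i` with `i < M`. -/
def minOver (M c : ℕ) (f : ℕ → ℕ) : ℕ :=
  Nat.rec c (fun i acc => min acc (f i)) M

theorem minOver_succ (M c : ℕ) (f : ℕ → ℕ) :
    minOver (M + 1) c f = min (minOver M c f) (f M) := rfl

theorem le_minOver {M c : ℕ} {f : ℕ → ℕ} {x : ℕ} :
    x ≤ minOver M c f ↔ x ≤ c ∧ ∀ i < M, x ≤ f i := by
  induction M with
  | zero => simp [minOver]
  | succ M ih =>
    rw [minOver_succ, le_min_iff, ih, Nat.forall_lt_succ_right, and_assoc]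

theorem minOver_eq_or (M c : ℕ) (f : ℕ → ℕ) :
    minOver M c f = c ∨ ∃ i < M, minOver M c f = f i := by
  induction M with
  | zero => exact Or.inl rfl
  | succ M ih =>
    rw [minOver_succ]
    rcases min_choice (minOver M c f) (f M) with h | h
    · rw [h]
      rcases ih with h | ⟨i, hi, h⟩
      · exact Or.inl h
      · exact Or.inr ⟨i, hi.trans (Nat.lt_succ_self M), h⟩
    · exact Or.inr ⟨M, Nat.lt_succ_self M, h⟩

/-- The total processing time of the jobs with interval in `a, …, b`, the data of job `m` being
`r m`, `d m`, `p m`. -/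
def load (M : ℕ) (r d p : ℕ → ℕ) (a b : ℕ) : ℕ :=
  ∑ m ∈ Finset.range M, if a ≤ r m then (if d m ≤ b then p m else 0) else 0

/-- An upper bound on the agreement if an event of length `l` is scheduled at `t` and jobs of total
processing time `w` have to be processed in the slots `a, …, b`: the number of slots that the event
or the interval `a, …, b` covers, minus `w`. -/
def capacity (N l a b w t : ℕ) : ℕ :=
  (min (t + l) (N + 1) - t + (b + 1 - a)) - (w + (min (b + 1) (t + l) - max a t))

/-- The least capacity over the intervals from a release time `r j` to a deadline `d k`, and the
empty interval. -/
def leastCapacity (M N l : ℕ) (r d p : ℕ → ℕ) (t : ℕ) : ℕ :=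
  minOver M (min (t + l) (N + 1) - t) fun j => minOver M (min (t + l) (N + 1) - t) fun k =>
    capacity N l (r j) (d k) (load M r d p (r j) (d k)) t

/-- What stands in for the jobs beyond the end of a job list.  As its release time and its deadline
delimit the empty interval, the empty interval is among those considered by `leastCapacity`. -/
def noJob : Job := ⟨1, 0, 0⟩

/-- The release time of job `j`. -/
def rel (J : List Job) (j : ℕ) : ℕ := (J.getD j noJob).release

/-- The deadline of job `j`, cut off at the end of the timeline. -/
def dl (N : ℕ) (J : List Job) (j : ℕ) : ℕ := min (J.getD j noJob).deadline N

/-- The processing time of job `j`. -/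
def proc (J : List Job) (j : ℕ) : ℕ := (J.getD j noJob).processing

section

variable {N : ℕ} {J : List Job}

theorem rel_fin (j : Fin J.length) : rel J j = (J.get j).release := by
  simp [rel]

theorem dl_fin (j : Fin J.length) : dl N J j = min (J.get j).deadline N := by
  simp [dl]

theorem proc_fin (j : Fin J.length) : proc J j = (J.get j).processing := by
  simp [proc]

theorem rel_of_le {j : ℕ} (h : J.length ≤ j) : rel J j = 1 := by
  rw [rel, List.getD_eq_default _ _ h]; rfl

theorem dl_of_le {j : ℕ} (h : J.length ≤ j) : dl N J j = 0 := by
  rw [dl, List.getD_eq_default _ _ h]; exact Nat.zero_min N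

theorem proc_of_le {j : ℕ} (h : J.length ≤ j) : proc J j = 0 := by
  rw [proc, List.getD_eq_default _ _ h]; rfl

theorem dl_le (j : ℕ) : dl N J j ≤ N := min_le_right _ _

theorem one_le_rel (hJ : ∀ j ∈ J, j.Valid) (j : ℕ) : 1 ≤ rel J j := by
  rcases Nat.lt_or_ge j J.length with h | h
  · have := (hJ _ (J.get_mem ⟨j, h⟩)).1
    rwa [← rel_fin] at this
  · rw [rel_of_le h]

theorem load_eq {M : ℕ} (hM : J.length ≤ M) (a b : ℕ) :
    load M (rel J) (dl N J) (proc J) a b =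
      ∑ j with a ≤ (J.get j).release ∧ min (J.get j).deadline N ≤ b, (J.get j).processing := by
  rw [load, ← Finset.sum_subset (Finset.range_subset_range.2 hM), Finset.sum_range,
    Finset.sum_filter]
  · refine Finset.sum_congr rfl fun j _ => ?_
    rw [rel_fin, dl_fin, proc_fin, ite_and]
  · intro j _ hj
    rw [Finset.mem_range, not_lt] at hj
    simp [proc_of_le hj]

/-- The interval criterion is necessary for feasibility. -/
theorem load_le {M : ℕ} (hM : J.length ≤ M) (h : ∃ s : JobSchedule J, s.Feasible N) (a b : ℕ) :
    load M (rel J) (dl N J) (proc J) a b ≤ b + 1 - a := by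
  obtain ⟨s, hs⟩ := h
  have := hs.idle_add_le (Finset.Icc a b)
    (Finset.univ.filter fun j => a ≤ (J.get j).release ∧ min (J.get j).deadline N ≤ b) (by
      intro j hj
      exact Finset.Icc_subset_Icc (Finset.mem_filter.1 hj).2.1 (Finset.mem_filter.1 hj).2.2)
  rw [← load_eq hM, Nat.card_Icc] at this
  omega

theorem capacity_spec {l a b w t : ℕ} (hw : w ≤ b + 1 - a) (hb : b ≤ N) :
    capacity N l a b w t + w + (min (b + 1) (t + l) - max a t) =
      min (t + l) (N + 1) - t + (b + 1 - a) := by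
  unfold capacity
  omega

theorem agr_le_capacity {M : ℕ} (hM : J.length ≤ M) (h : ∃ s : JobSchedule J, s.Feasible N)
    {l a b t : ℕ} (hl : 1 ≤ l) (hb : b ≤ N) :
    agr N J (Finset.Icc t (min (t + l - 1) N)) ≤
      capacity N l a b (load M (rel J) (dl N J) (proc J) a b) t := by
  have hle := load_le hM h a b
  obtain ⟨s, hs, he⟩ := exists_agreement_eq_agr h (Finset.Icc t (min (t + l - 1) N))
  rw [← he]
  have h₁ := hs.idle_add_le (Finset.Icc a b)
    (Finset.univ.filter fun j => a ≤ (J.get j).release ∧ min (J.get j).deadline N ≤ b) (by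
      intro j hj
      exact Finset.Icc_subset_Icc (Finset.mem_filter.1 hj).2.1 (Finset.mem_filter.1 hj).2.2)
  rw [← load_eq hM, Nat.card_Icc] at h₁
  set S := Finset.Icc t (min (t + l - 1) N) with hS
  have h₂ : s.agreement S ≤ (S \ Finset.Icc a b).card +
      ((Finset.Icc a b).filter fun t => s t = none).card := by
    refine (Finset.card_le_card fun u hu => ?_).trans (Finset.card_union_le _ _)
    obtain ⟨hu, hn⟩ := Finset.mem_filter.1 hu
    by_cases hI : u ∈ Finset.Icc a b
    · exact Finset.mem_union_right _ (Finset.mem_filter.2 ⟨hI, hn⟩)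
    · exact Finset.mem_union_left _ (Finset.mem_sdiff.2 ⟨hu, hI⟩)
  have h₃ := Finset.card_sdiff_add_card_inter S (Finset.Icc a b)
  have h₄ : S ∩ Finset.Icc a b = Finset.Icc (max a t) (min b (min (t + l - 1) N)) := by
    ext u
    simp only [hS, Finset.mem_inter, Finset.mem_Icc]
    omega
  rw [h₄, hS, Nat.card_Icc, Nat.card_Icc, ← hS] at h₃
  unfold capacity
  omega

/-- The maximum agreement is the least capacity.  If `D` is the least capacity and jobs with a total
processing time `w` have to be processed within an interval around the event, then the capacity of
the interval from the first of their release times to the last of their deadlines shows that the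
larger interval has room for `D` more slots. -/
theorem agr_eq_leastCapacity {M : ℕ} (hM : J.length < M) (hJ : ∀ j ∈ J, j.Valid)
    (h : ∃ s : JobSchedule J, s.Feasible N) {l t : ℕ} (hl : 1 ≤ l) (ht : 1 ≤ t) (htN : t ≤ N) :
    agr N J (Finset.Icc t (min (t + l - 1) N)) =
      leastCapacity M N l (rel J) (dl N J) (proc J) t := by
  have hs : agr N J (Finset.Icc t (min (t + l - 1) N)) ≤ min (t + l) (N + 1) - t := by
    have := agr_le_capacity hM.le h (a := 1) (b := 0) (t := t) hl (Nat.zero_le _)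
    unfold capacity at this
    omega
  apply le_antisymm
  · exact le_minOver.2 ⟨hs, fun j _ => le_minOver.2 ⟨hs, fun k _ =>
      agr_le_capacity hM.le h hl (dl_le k)⟩⟩
  set D := leastCapacity M N l (rel J) (dl N J) (proc J) t with hD
  obtain ⟨hD₀, hD₁⟩ := le_minOver.1 hD.le
  apply le_agr_of_interval_bound hJ
  · intro x y
    rw [← load_eq hM.le]
    exact load_le hM.le h x y
  intro x y hx hy
  set K : Finset (Fin J.length) :=
    Finset.univ.filter fun j => x ≤ (J.get j).release ∧ min (J.get j).deadline N ≤ y with hK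
  rcases K.eq_empty_or_nonempty with hKe | hKne
  · rw [hKe, Finset.sum_empty]
    omega
  obtain ⟨j, hj, hjmin⟩ := K.exists_min_image (fun j => (J.get j).release) hKne
  obtain ⟨k, hk, hkmax⟩ := K.exists_max_image (fun j => min (J.get j).deadline N) hKne
  have hDjk := (le_minOver.1 (hD₁ j (j.2.trans hM))).2 k (k.2.trans hM)
  have hle : ∑ i ∈ K, (J.get i).processing ≤
      load M (rel J) (dl N J) (proc J) (rel J j) (dl N J k) := by
    rw [load_eq hM.le]
    refine Finset.sum_le_sum_of_subset fun i hi => Finset.mem_filter.2 ⟨Finset.mem_univ i, ?_, ?_⟩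
    · rw [rel_fin]; exact hjmin i hi
    · rw [dl_fin]; exact hkmax i hi
  have hw := load_le hM.le h (rel J j) (dl N J k)
  have hc := capacity_spec (l := l) (t := t) hw (dl_le k)
  have hdN : dl N J k ≤ N := dl_le k
  have hpos : 1 ≤ (J.get j).processing := (hJ _ (J.get_mem j)).2.2.1
  have hpos' := hpos.trans
    (Finset.single_le_sum (f := fun i => (J.get i).processing) (fun _ _ => Nat.zero_le _) hj)
  have h₁ : x ≤ rel J j := by rw [rel_fin]; exact (Finset.mem_filter.1 hj).2.1
  have h₂ : dl N J k ≤ y := by rw [dl_fin]; exact (Finset.mem_filter.1 hk).2.2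
  omega

end

end PSBA

/-! ### Turning points of a minimum of piecewise linear functions -/

namespace PSBA

/-- Suppose that `g` is the minimum of functions with slopes `-1`, `0`, `1` that turn only at the
points of `B`.  Then each turning point of `g` lies in `B`, or next to the crossing of two of the
functions `f i` and `f k`, which after the last point `u` of `B` approach each other at speed `1` or
`2`; hence the distance from `u` is the difference of their values at `u`, or half of it, up to
`1`. -/
theorem exists_crossing {ι : Type*} {f : ι → ℕ → ℤ} {g : ℕ → ℤ} {N : ℕ}
    (hle : ∀ i x, 1 ≤ x → x ≤ N → g x ≤ f i x)
    (hatt : ∀ x, 1 ≤ x → x ≤ N → ∃ i, g x = f i x)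
    (hslope : ∀ i x, 1 ≤ x → x + 1 ≤ N → f i (x + 1) - f i x ≤ 1 ∧ -1 ≤ f i (x + 1) - f i x)
    {B : ℕ → Prop} (h₁ : B 1)
    (hB : ∀ i x, 1 < x → x < N → ¬ B x → f i (x + 1) - f i x = f i x - f i (x - 1))
    {t : ℕ} (ht : 1 < t) (htN : t < N) (hturn : g (t + 1) - g t ≠ g t - g (t - 1)) :
    ∃ u, B u ∧ 1 ≤ u ∧ u ≤ t ∧ ∃ i k, ∃ D ε : ℕ, ε ≤ 2 ∧ f i u ≤ f k u ∧
      (D = (f k u - f i u).toNat ∨ D = (f k u - f i u).toNat / 2) ∧ t + 1 = u + D + ε := by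
  classical
  by_cases hBt : B t
  · obtain ⟨i, -⟩ := hatt t ht.le htN.le
    exact ⟨t, hBt, ht.le, le_rfl, i, i, 0, 1, by norm_num, le_rfl, Or.inl (by simp), rfl⟩
  set u := Nat.findGreatest B t with hu
  have hBu : B u := Nat.findGreatest_spec ht.le h₁
  have hu₁ : 1 ≤ u := Nat.le_findGreatest ht.le h₁
  have hut : u ≤ t := Nat.findGreatest_le t
  have hne : u ≠ t := fun h => hBt (h ▸ hBu)
  have hlast : ∀ x, u < x → x ≤ t → ¬ B x := fun x h h' => Nat.findGreatest_is_greatest h h'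
  clear_value u
  obtain ⟨m, rfl⟩ : ∃ m, t = u + m + 1 := ⟨t - u - 1, by omega⟩
  have hstep : ∀ i n, n ≤ m + 1 → f i (u + n + 1) - f i (u + n) = f i (u + 1) - f i u := by
    intro i n
    induction n with
    | zero => simp
    | succ n ih =>
      intro hn
      have hnB : ¬ B (u + n + 1) := hlast _ (by omega) (by omega)
      have := hB i (u + n + 1) (by omega) (by omega) hnB
      rw [Nat.add_sub_cancel] at this
      rw [← ih (by omega), ← add_assoc, this]
  have hlin : ∀ i n, n ≤ m + 2 → f i (u + n) = f i u + n * (f i (u + 1) - f i u) := by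
    intro i n
    induction n with
    | zero => simp
    | succ n ih =>
      intro hn
      have h₁ := hstep i n (by omega)
      have h₂ := ih (by omega)
      push_cast
      rw [← add_assoc]
      linarith
  obtain ⟨i, hi⟩ := hatt (u + m) (by omega) (by omega)
  obtain ⟨k, hk⟩ := hatt (u + m + 1 + 1) (by omega) (by omega)
  obtain ⟨c, hc⟩ := hatt (u + m + 1) (by omega) (by omega)
  rw [Nat.add_sub_cancel] at hturn
  have e₁ := hle c (u + m) (by omega) (by omega)
  have e₂ := hle c (u + m + 1 + 1) (by omega) (by omega)
  have e₃ := hle i (u + m + 1) (by omega) (by omega)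
  have e₄ := hle i (u + m + 1 + 1) (by omega) (by omega)
  have e₅ := hle k (u + m + 1) (by omega) (by omega)
  have e₆ := hle k (u + m) (by omega) (by omega)
  have c₁ := hstep c m (by omega)
  have c₂ := hstep c (m + 1) le_rfl
  have i₁ := hstep i m (by omega)
  have i₂ := hstep i (m + 1) le_rfl
  have k₁ := hstep k m (by omega)
  have k₂ := hstep k (m + 1) le_rfl
  simp only [← add_assoc] at c₁ c₂ i₁ i₂ k₁ k₂
  have li := hlin i m (by omega)
  have lk := hlin k m (by omega)
  obtain ⟨si₁, si₂⟩ := hslope i u hu₁ (by omega)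
  obtain ⟨sk₁, sk₂⟩ := hslope k u hu₁ (by omega)
  set a := f i (u + 1) - f i u with ha
  set b := f k (u + 1) - f k u with hb
  -- the slope of `g` drops at the turning point, so `f k` is less steep than `f i`
  have hab : b < a := by omega
  refine ⟨u, hBu, hu₁, hut, i, k, ?_⟩
  clear_value a b
  have hcases : (a = 1 ∧ b = 0) ∨ (a = 0 ∧ b = -1) ∨ (a = 1 ∧ b = -1) := by omega
  rcases hcases with ⟨rfl, rfl⟩ | ⟨rfl, rfl⟩ | ⟨rfl, rfl⟩
  · refine ⟨(f k u - f i u).toNat, u + m + 2 - u - (f k u - f i u).toNat, ?_, ?_, Or.inl rfl, ?_⟩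
      <;> omega
  · refine ⟨(f k u - f i u).toNat, u + m + 2 - u - (f k u - f i u).toNat, ?_, ?_, Or.inl rfl, ?_⟩
      <;> omega
  · refine ⟨(f k u - f i u).toNat / 2, u + m + 2 - u - (f k u - f i u).toNat / 2, ?_, ?_,
      Or.inr rfl, ?_⟩
      <;> omega

/-- The points at which a capacity can turn, in terms of a release time `a` or a deadline `b`; the
end of the timeline and the last slot at which the event fits in are included. -/
def breakpoint (N l a b e : ℕ) : ℕ :=
  if e = 0 then a else if e = 1 then a - l else if e = 2 then b + 1 else if e = 3 then b + 1 - l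
  else if e = 4 then N + 1 - l else N

theorem capacity_slope {N l a b w x : ℕ} (hl : 1 ≤ l) (hw : w ≤ b + 1 - a) (hb : b ≤ N)
    (hx : x + 1 ≤ N) :
    (capacity N l a b w (x + 1) : ℤ) - capacity N l a b w x ≤ 1 ∧
      -1 ≤ (capacity N l a b w (x + 1) : ℤ) - capacity N l a b w x := by
  have h₁ := capacity_spec (l := l) (t := x) hw hb
  have h₂ := capacity_spec (l := l) (t := x + 1) hw hb
  omega

theorem capacity_linear {N l a b w x : ℕ} (hl : 1 ≤ l) (hw : w ≤ b + 1 - a) (ha : 1 ≤ a)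
    (hb : b ≤ N) (hx : 1 < x) (hxN : x < N)
    (hB : ∀ e < 5, x ≠ breakpoint N l a b e) :
    (capacity N l a b w (x + 1) : ℤ) - capacity N l a b w x =
      capacity N l a b w x - capacity N l a b w (x - 1) := by
  have h₁ := capacity_spec (l := l) (t := x) hw hb
  have h₂ := capacity_spec (l := l) (t := x + 1) hw hb
  have h₃ := capacity_spec (l := l) (t := x - 1) hw hb
  have b₀ := hB 0 (by norm_num)
  have b₁ := hB 1 (by norm_num)
  have b₂ := hB 2 (by norm_num)
  have b₃ := hB 3 (by norm_num)
  have b₄ := hB 4 (by norm_num)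
  simp only [breakpoint, one_ne_zero, if_true, if_false, OfNat.ofNat_ne_zero, OfNat.ofNat_ne_one,
    show (3 : ℕ) ≠ 2 by norm_num, show (4 : ℕ) ≠ 2 by norm_num, show (4 : ℕ) ≠ 3 by norm_num] at *
  have hs : ((min (x + 1 + l) (N + 1) - (x + 1) : ℕ) : ℤ) - (min (x + l) (N + 1) - x : ℕ) =
      (min (x + l) (N + 1) - x : ℕ) - (min (x - 1 + l) (N + 1) - (x - 1) : ℕ) := by
    clear h₁ h₂ h₃
    omega
  have hq : ((min (b + 1) (x + 1 + l) - max a (x + 1) : ℕ) : ℤ) -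
        (min (b + 1) (x + l) - max a x : ℕ) =
      (min (b + 1) (x + l) - max a x : ℕ) -
        (min (b + 1) (x - 1 + l) - max a (x - 1) : ℕ) := by
    clear h₁ h₂ h₃ hs
    have hmax : (max a (x + 1) = a ∧ max a x = a ∧ max a (x - 1) = a ∧ x < a) ∨
        (max a (x + 1) = x + 1 ∧ max a x = x ∧ max a (x - 1) = x - 1 ∧ a < x) := by omega
    have hmin : (min (b + 1) (x + 1 + l) = x + 1 + l ∧ min (b + 1) (x + l) = x + l ∧
          min (b + 1) (x - 1 + l) = x - 1 + l ∧ x + l ≤ b) ∨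
        (min (b + 1) (x + 1 + l) = b + 1 ∧ min (b + 1) (x + l) = b + 1 ∧
          min (b + 1) (x - 1 + l) = b + 1 ∧ b + 1 < x + l) := by omega
    rcases hmax with ⟨m₁, m₂, m₃, m₄⟩ | ⟨m₁, m₂, m₃, m₄⟩ <;>
      rcases hmin with ⟨n₁, n₂, n₃, n₄⟩ | ⟨n₁, n₂, n₃, n₄⟩ <;>
      rw [m₁, m₂, m₃, n₁, n₂, n₃] <;> omega
  zify at h₁ h₂ h₃
  linarith

end PSBA

/-! ### Candidates for turning points -/

namespace PSBA

/-- Half of `y`, rounded down and cut off below `2 ^ M`, bit by bit from the highest one: the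
machine cannot divide. -/
def halve (M y : ℕ) : ℕ :=
  Nat.rec 0 (fun i acc =>
    if y < acc + 2 ^ min (M - (i + 1)) M + (acc + 2 ^ min (M - (i + 1)) M) then acc
    else acc + 2 ^ min (M - (i + 1)) M) M

theorem halve_eq {M y : ℕ} (h : y < 2 ^ M) : halve M y = y / 2 := by
  have key : ∀ i ≤ M, ∃ acc, Nat.rec (motive := fun _ => ℕ) 0 (fun i acc =>
      if y < acc + 2 ^ min (M - (i + 1)) M + (acc + 2 ^ min (M - (i + 1)) M) then acc
      else acc + 2 ^ min (M - (i + 1)) M) i = acc ∧ acc ≤ y / 2 ∧ y / 2 < acc + 2 ^ (M - i) := by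
    intro i
    induction i with
    | zero => intro _; exact ⟨0, rfl, by omega, by rw [Nat.sub_zero]; omega⟩
    | succ i ih =>
      intro hi
      obtain ⟨acc, he, h₁, h₂⟩ := ih (by omega)
      refine ⟨_, rfl, ?_⟩
      have hpow : 2 ^ (M - i) = 2 ^ (M - (i + 1)) + 2 ^ (M - (i + 1)) := by
        rw [show M - i = M - (i + 1) + 1 by omega, pow_succ]; ring
      dsimp only
      rw [he, min_eq_left (by omega : M - (i + 1) ≤ M)]
      split_ifs <;> omega
  obtain ⟨acc, he, h₁, h₂⟩ := key M le_rfl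
  rw [Nat.sub_self, pow_zero] at h₂
  rw [halve, he]
  omega

section

variable (M N l : ℕ) (r d p : ℕ → ℕ)

/-- The capacity at `t` that belongs to the interval from release time `r j` to deadline `d k`. -/
def jobCapacity (j k t : ℕ) : ℕ :=
  capacity N l (r j) (d k) (load M r d p (r j) (d k)) t

/-- The distance from `u` at which the capacities of `k₁, k₂` and of `m₁, m₂` may cross, if they
approach each other at speed `1` (for `h = 0`) or `2` (otherwise). -/
def crossing (k₁ k₂ m₁ m₂ h u : ℕ) : ℕ :=
  if h = 0 then jobCapacity M N l r d p m₁ m₂ u - jobCapacity M N l r d p k₁ k₂ u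
  else halve M (jobCapacity M N l r d p m₁ m₂ u - jobCapacity M N l r d p k₁ k₂ u)

/-- The candidates for turning points: after a breakpoint, given by `j` and `e`, a slot next to
the crossing of two capacities.  Candidates are forced into `1, …, T`. -/
def candidate (T j e k₁ k₂ m₁ m₂ h ε : ℕ) : ℕ :=
  min (max (breakpoint N l (r j) (d j) e +
    crossing M N l r d p k₁ k₂ m₁ m₂ h (breakpoint N l (r j) (d j) e) + ε - 1) 1) T

/-- `t` is a candidate, with all indices below `K`. -/
def IsCandidate (K T t : ℕ) : Prop :=
  ∃ j < K, ∃ e < K, ∃ k₁ < K, ∃ k₂ < K, ∃ m₁ < K, ∃ m₂ < K, ∃ h < K, ∃ ε < K,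
    candidate M N l r d p T j e k₁ k₂ m₁ m₂ h ε = t

end

variable {M N l : ℕ} {r d p : ℕ → ℕ}

theorem IsCandidate.mono {K K' T t : ℕ} (hK : K ≤ K') (h : IsCandidate M N l r d p K T t) :
    IsCandidate M N l r d p K' T t := by
  obtain ⟨j, h₁, e, h₂, k₁, h₃, k₂, h₄, m₁, h₅, m₂, h₆, h, h₇, ε, h₈, he⟩ := h
  exact ⟨j, h₁.trans_le hK, e, h₂.trans_le hK, k₁, h₃.trans_le hK, k₂, h₄.trans_le hK,
    m₁, h₅.trans_le hK, m₂, h₆.trans_le hK, h, h₇.trans_le hK, ε, h₈.trans_le hK, he⟩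

theorem candidate_mem {T : ℕ} (hT : 1 ≤ T) (j e k₁ k₂ m₁ m₂ h ε : ℕ) :
    1 ≤ candidate M N l r d p T j e k₁ k₂ m₁ m₂ h ε ∧
      candidate M N l r d p T j e k₁ k₂ m₁ m₂ h ε ≤ T := by
  unfold candidate
  omega

theorem isCandidate_breakpoint {K T j e u : ℕ} (hK : 6 ≤ K) (hj : j < K) (he : e < K)
    (hu : breakpoint N l (r j) (d j) e = u) (h₁ : 1 ≤ u) (hT : u ≤ T) :
    IsCandidate M N l r d p K T u := by
  refine ⟨j, hj, e, he, 0, by omega, 0, by omega, 0, by omega, 0, by omega, 0, by omega, 1,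
    by omega, ?_⟩
  unfold candidate crossing
  rw [hu, if_pos rfl, Nat.sub_self]
  omega

/-- A candidate is determined by its eight indices. -/
theorem card_le_of_isCandidate {K T : ℕ} {S : Finset ℕ}
    (h : ∀ t ∈ S, IsCandidate M N l r d p K T t) : S.card ≤ K ^ 8 := by
  classical
  have hsub : S ⊆ (Finset.univ : Finset (Fin 8 → Fin K)).image fun v =>
      candidate M N l r d p T (v 0) (v 1) (v 2) (v 3) (v 4) (v 5) (v 6) (v 7) := by
    intro t ht
    obtain ⟨j, h₁, e, h₂, k₁, h₃, k₂, h₄, m₁, h₅, m₂, h₆, h, h₇, ε, h₈, he⟩ := h t ht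
    exact Finset.mem_image.2 ⟨![⟨j, h₁⟩, ⟨e, h₂⟩, ⟨k₁, h₃⟩, ⟨k₂, h₄⟩, ⟨m₁, h₅⟩, ⟨m₂, h₆⟩, ⟨h, h₇⟩,
      ⟨ε, h₈⟩], Finset.mem_univ _, he⟩
  refine (Finset.card_le_card hsub).trans (Finset.card_image_le.trans ?_)
  simp

/-- All turning points of the agreement function are candidates. -/
theorem isCandidate_of_turning {J : List Job} (hJ : ∀ j ∈ J, j.Valid)
    (hfeas : ∃ s : JobSchedule J, s.Feasible N) (hl : 1 ≤ l) (hM : J.length < M)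
    (hMN : 2 * N < 2 ^ M) {g : ℕ → ℕ}
    (hg : ∀ t, 1 ≤ t → t ≤ N → g t = leastCapacity M N l (rel J) (dl N J) (proc J) t)
    {T t : ℕ} (hT : t ≤ T) (ht : t ∈ turningPoints N g) :
    IsCandidate M N l (rel J) (dl N J) (proc J) (J.length + 6) T t := by
  obtain ⟨htI, hturn⟩ := Finset.mem_filter.1 ht
  obtain ⟨ht₁, htN⟩ := Finset.mem_Ioo.1 htI
  set n := J.length with hn
  set cap := jobCapacity M N l (rel J) (dl N J) (proc J) with hcap
  have hrel : ∀ j, rel J (min j n) = rel J j := by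
    intro j
    rcases Nat.le_total j n with h | h
    · rw [min_eq_left h]
    · rw [min_eq_right h, rel_of_le le_rfl, rel_of_le h]
  have hdl : ∀ j, dl N J (min j n) = dl N J j := by
    intro j
    rcases Nat.le_total j n with h | h
    · rw [min_eq_left h]
    · rw [min_eq_right h, dl_of_le le_rfl, dl_of_le h]
  have hload := fun a b => load_le (N := N) hM.le hfeas a b
  obtain ⟨u, ⟨j, hj, e, he, hu⟩, hu₁, hut, i, k, D, ε, hε, -, hD, hsum⟩ := exists_crossing
    (ι := Fin (n + 1) × Fin (n + 1)) (f := fun i x => (cap i.1 i.2 x : ℤ)) (g := fun x => (g x : ℤ))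
    (N := N) (B := fun x => ∃ j ≤ n, ∃ e < 6, breakpoint N l (rel J j) (dl N J j) e = x)
    (fun i x h₁ h₂ => by
      have := (hg x h₁ h₂).le
      have := (le_minOver.1 ((le_minOver.1 this).2 i.1 (by have := i.1.2; omega))).2 i.2
        (by have := i.2.2; omega)
      exact_mod_cast this)
    (fun x h₁ h₂ => by
      have hnil : min (x + l) (N + 1) - x = cap n n x := by
        have hc := capacity_spec (l := l) (t := x) (hload (rel J n) (dl N J n)) (dl_le n)
        have := hload (rel J n) (dl N J n)
        simp only [hcap, jobCapacity]
        rw [rel_of_le le_rfl, dl_of_le le_rfl] at *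
        omega
      have hmain : ∃ j k, g x = cap j k x := by
        rw [hg x h₁ h₂]
        rcases minOver_eq_or M (min (x + l) (N + 1) - x) (fun j => minOver M
          (min (x + l) (N + 1) - x) fun k => cap j k x) with h | ⟨j, -, h⟩
        · exact ⟨n, n, h.trans hnil⟩
        · rcases minOver_eq_or M (min (x + l) (N + 1) - x) (fun k => cap j k x) with h' | ⟨k, -, h'⟩
          · exact ⟨n, n, h.trans (h'.trans hnil)⟩
          · exact ⟨j, k, h.trans h'⟩
      obtain ⟨j, k, h⟩ := hmain
      refine ⟨(⟨min j n, by omega⟩, ⟨min k n, by omega⟩), ?_⟩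
      simp only [hcap, jobCapacity, hrel, hdl] at h ⊢
      exact_mod_cast h)
    (fun i x h₁ h₂ => capacity_slope hl (hload _ _) (dl_le _) h₂)
    ⟨n, le_rfl, 0, by norm_num, rel_of_le le_rfl⟩
    (fun i x h₁ h₂ hB => by
      refine capacity_linear hl (hload _ _) (one_le_rel hJ _) (dl_le _) h₁ h₂ fun e he hx => hB ?_
      by_cases he' : e < 2
      · refine ⟨i.1, by have := i.1.2; omega, e, by omega, ?_⟩
        rw [hx]
        interval_cases e <;> simp [breakpoint]
      · refine ⟨i.2, by have := i.2.2; omega, e, by omega, ?_⟩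
        rw [hx]
        interval_cases e <;> simp [breakpoint])
    ht₁ htN hturn
  have hδ : cap k.1 k.2 u - cap i.1 i.2 u < 2 ^ M := by
    have : cap k.1 k.2 u ≤ 2 * N := by
      simp only [hcap, jobCapacity, capacity]
      have h₁ := one_le_rel hJ k.1
      have h₂ : dl N J k.2 ≤ N := dl_le k.2
      omega
    omega
  have hsub : ((cap k.1 k.2 u : ℤ) - cap i.1 i.2 u).toNat = cap k.1 k.2 u - cap i.1 i.2 u := by
    omega
  rw [hsub] at hD
  have hi₁ := i.1.2
  have hi₂ := i.2.2
  have hk₁ := k.1.2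
  have hk₂ := k.2.2
  obtain ⟨h, hh, hcross⟩ : ∃ h < 2, crossing M N l (rel J) (dl N J) (proc J) i.1 i.2 k.1 k.2 h u
      = D := by
    rcases hD with hD | hD
    · exact ⟨0, by norm_num, by rw [hD]; rfl⟩
    · exact ⟨1, by norm_num, by rw [hD, ← halve_eq hδ]; rfl⟩
  refine ⟨j, by omega, e, by omega, i.1, by omega, i.2, by omega, k.1, by omega, k.2, by omega,
    h, by omega, ε, by omega, ?_⟩
  unfold candidate
  rw [hu, hcross]
  omega

/-! ### Instances with one event -/

theorem occupied_single (N l : ℕ) (A : List (List Job)) {t : ℕ} (ht : 1 ≤ t) :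
    (⟨N, [l], A⟩ : Instance).occupied (fun _ => t) = Finset.Icc t (min (t + l - 1) N) := by
  ext x
  simp only [Instance.occupied, timeline, Finset.mem_filter, Finset.mem_Icc]
  constructor
  · rintro ⟨h, ⟨e, he⟩, h₁, h₂⟩
    have he' : e = 0 := by simpa using he
    subst he'
    simp only [List.get_eq_getElem, List.getElem_cons_zero] at h₂
    omega
  · intro h
    refine ⟨by omega, ⟨0, by simp⟩, h.1, ?_⟩
    simp only [List.get_eq_getElem, List.getElem_cons_zero]
    omega

theorem g_eq {N l : ℕ} {A : List (List Job)} (hI : (⟨N, [l], A⟩ : Instance).Valid) {J : List Job}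
    (hJ : J ∈ A) {M : ℕ} (hM : J.length < M) {t : ℕ} (ht : 1 ≤ t) (htN : t ≤ N) :
    (⟨N, [l], A⟩ : Instance).g J t = leastCapacity M N l (rel J) (dl N J) (proc J) t := by
  rw [Instance.g, occupied_single N l A ht]
  exact agr_eq_leastCapacity hM (hI.2.2 J hJ).1 (hI.2.2 J hJ).2 (hI.2.1 l (by simp)) ht htN

theorem linearBetween_turningPoints (N : ℕ) (f : ℕ → ℕ) :
    LinearBetween ({1, N} ∪ turningPoints N f) f := by
  intro a ha b hb hab hc t ht
  have hmem : ∀ x ∈ ({1, N} ∪ turningPoints N f : Finset ℕ), x = 1 ∨ x = N ∨ 1 < x ∧ x < N := by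
    intro x hx
    simp only [Finset.mem_union, Finset.mem_insert, Finset.mem_singleton] at hx
    rcases hx with (h | h) | h
    · exact Or.inl h
    · exact Or.inr (Or.inl h)
    · exact Or.inr (Or.inr (Finset.mem_Ioo.1 (Finset.mem_filter.1 h).1))
  have hN : N ∈ ({1, N} ∪ turningPoints N f : Finset ℕ) := by simp
  have h1 : 1 ∈ ({1, N} ∪ turningPoints N f : Finset ℕ) := by simp
  have hcN := hc N hN
  have hc1 := hc 1 h1
  have hma := hmem a ha
  have hmb := hmem b hb
  have hstep : ∀ m, a + m + 1 ≤ b → (f (a + m + 1) : ℤ) - f (a + m) = f (a + 1) - f a := by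
    intro m
    induction m with
    | zero => simp
    | succ m ih =>
      intro hm
      rw [← ih (by omega)]
      by_contra hne
      by_cases hin : 1 < a + m + 1 ∧ a + m + 1 < N
      · refine hc (a + m + 1) (Finset.mem_union_right _ (Finset.mem_filter.2
          ⟨Finset.mem_Ioo.2 hin, ?_⟩)) (by omega)
        rw [Nat.add_sub_cancel]
        exact hne
      · omega
  have hlin : ∀ m, a + m ≤ b → (f (a + m) : ℤ) = f a + m * (f (a + 1) - f a) := by
    intro m
    induction m with
    | zero => simp
    | succ m ih =>
      intro hm
      have h₁ := hstep m (by omega)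
      have h₂ := ih (by omega)
      push_cast
      rw [← add_assoc]
      linarith
  obtain ⟨hat, htb⟩ := Finset.mem_Icc.1 ht
  obtain ⟨m, rfl⟩ := Nat.exists_eq_add_of_le hat
  obtain ⟨k, rfl⟩ := Nat.exists_eq_add_of_le hab.le
  rw [hlin m htb, hlin k le_rfl]
  push_cast
  ring

/-- The last slot to be considered for an event of length `l`: in later slots it occupies less. -/
def lastStart (N l : ℕ) : ℕ := max 1 (N + 1 - l)

/-- The sum of the agreement functions is maximal at a turning point of one of them, or at an end of
the range to be considered. -/
theorem exists_optimal {N l : ℕ} {A : List (List Job)} (hI : (⟨N, [l], A⟩ : Instance).Valid) :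
    ∃ t, 1 ≤ t ∧ t ≤ lastStart N l ∧
      (t = 1 ∨ t = lastStart N l ∨ ∃ J ∈ A, t ∈ turningPoints N ((⟨N, [l], A⟩ : Instance).g J)) ∧
      ∀ t', 1 ≤ t' → t' ≤ N → (A.map fun J => (⟨N, [l], A⟩ : Instance).g J t').sum ≤
        (A.map fun J => (⟨N, [l], A⟩ : Instance).g J t).sum := by
  classical
  set I : Instance := ⟨N, [l], A⟩ with hIdef
  set T := lastStart N l with hT
  have hN : 1 ≤ N := hI.1
  have hl : 1 ≤ l := hI.2.1 l (by simp [hIdef])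
  have hTN : 1 ≤ T ∧ T ≤ N := by simp only [hT, lastStart]; omega
  set f : ℕ → ℕ := fun t => (A.map fun J => I.g J t).sum with hf
  have hex : ∃ t, 1 ≤ t ∧ t ≤ T ∧ ∀ t', 1 ≤ t' → t' ≤ T → f t' ≤ f t := by
    obtain ⟨t, ht, hmax⟩ := (Finset.Icc 1 T).exists_max_image f ⟨1, Finset.mem_Icc.2 ⟨le_rfl, hTN.1⟩⟩
    rw [Finset.mem_Icc] at ht
    exact ⟨t, ht.1, ht.2, fun t' h h' => hmax t' (Finset.mem_Icc.2 ⟨h, h'⟩)⟩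
  obtain ⟨h₁, h₂, hmax⟩ := Nat.find_spec hex
  refine ⟨Nat.find hex, h₁, h₂, ?_, ?_⟩
  · by_contra! hcon
    obtain ⟨hc₁, hc₂, hc₃⟩ := hcon
    set t := Nat.find hex with ht
    have hsum : ∀ B ⊆ A, (B.map fun J => I.g J (t + 1)).sum + (B.map fun J => I.g J (t - 1)).sum =
        2 * (B.map fun J => I.g J t).sum := by
      intro B
      induction B with
      | nil => simp
      | cons J B ih =>
        intro hB
        have hJ := hc₃ J (hB List.mem_cons_self)
        have := ih fun x hx => hB (List.mem_cons_of_mem _ hx)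
        rw [turningPoints, Finset.mem_filter, not_and, Finset.mem_Ioo] at hJ
        have := hJ ⟨by omega, by omega⟩
        simp only [List.map_cons, List.sum_cons]
        omega
    have hs := hsum A fun _ h => h
    have hup := hmax (t + 1) (by omega) (by omega)
    -- as the least maximizer, `t` is preceded by a strictly smaller value
    have hlow : f (t - 1) < f t := by
      by_contra! hge
      exact Nat.find_min hex (m := t - 1) (by omega)
        ⟨by omega, by omega, fun t' h h' => (hmax t' h h').trans hge⟩
    simp only [hf] at hup hlow
    omega
  · intro t' ht' htN'
    rcases Nat.le_total t' T with h | h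
    · exact hmax t' ht' h
    · refine le_trans (List.sum_le_sum fun J hJ => ?_) (hmax T hTN.1 le_rfl)
      have hsub : I.occupied (fun _ => t') ⊆ I.occupied (fun _ => T) := by
        rw [hIdef, occupied_single N l A ht', occupied_single N l A hTN.1]
        refine Finset.Icc_subset_Icc h ?_
        simp only [hT, lastStart]
        omega
      exact agr_mono (hI.2.2 J hJ).2 hsub

end PSBA

/-! ### Reading an instance from its encoding -/

namespace PSBA

section

variable (x : ℕ → ℕ) (M : ℕ)

/-- The position in the encoding `x` at which the data of agent `i` start. -/
def agentPos (i : ℕ) : ℕ :=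
  Nat.rec 4 (fun k acc => if k < i then acc + 1 + (x acc + x acc + x acc) else acc) M

/-- The release time of job `j` of agent `i`. -/
def relAt (i j : ℕ) : ℕ :=
  if j < x (agentPos x M i) then x (agentPos x M i + 1 + (j + j + j)) else 1

/-- The deadline of job `j` of agent `i`, cut off at the end of the timeline. -/
def dlAt (i j : ℕ) : ℕ :=
  if j < x (agentPos x M i) then min (x (agentPos x M i + 2 + (j + j + j))) (x 0) else 0

/-- The processing time of job `j` of agent `i`. -/
def procAt (i j : ℕ) : ℕ :=
  if j < x (agentPos x M i) then x (agentPos x M i + 3 + (j + j + j)) else 0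

/-- The agreement function of agent `i`. -/
def agreementAt (i t : ℕ) : ℕ :=
  leastCapacity M (x 0) (x 2) (relAt x M i) (dlAt x M i) (procAt x M i) t

/-- The sum of the agreement functions. -/
def totalAt (t : ℕ) : ℕ :=
  ∑ i ∈ Finset.range M, if i < x 3 then agreementAt x M i t else 0

/-- The candidates for turning points of the agreement function of agent `i`. -/
def candidateAt (i T j e k₁ k₂ m₁ m₂ h ε : ℕ) : ℕ :=
  candidate M (x 0) (x 2) (relAt x M i) (dlAt x M i) (procAt x M i) T j e k₁ k₂ m₁ m₂ h ε

/-- The maximum of `f` over the candidates of all agents. -/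
def maxOverCandidates (f : ℕ → ℕ) : ℕ :=
  (Finset.range M).sup fun i => (Finset.range M).sup fun j => (Finset.range M).sup fun e =>
    (Finset.range M).sup fun k₁ => (Finset.range M).sup fun k₂ => (Finset.range M).sup fun m₁ =>
    (Finset.range M).sup fun m₂ => (Finset.range M).sup fun h => (Finset.range M).sup fun ε =>
      f (candidateAt x M i (max 1 (x 0 + 1 - x 2)) j e k₁ k₂ m₁ m₂ h ε)

/-- The largest candidate at which the sum of the agreement functions is as large as at any other
candidate. -/
def bestCandidate : ℕ :=
  maxOverCandidates x M fun t =>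
    if totalAt x M t = maxOverCandidates x M (totalAt x M) then t else 0

/-- The candidates of the first agent. -/
def candidateList : List ℕ :=
  (List.range M).flatMap fun j => (List.range M).flatMap fun e =>
    (List.range M).flatMap fun k₁ => (List.range M).flatMap fun k₂ =>
    (List.range M).flatMap fun m₁ => (List.range M).flatMap fun m₂ =>
    (List.range M).flatMap fun h => (List.range M).flatMap fun ε =>
      [candidateAt x M 0 (x 0) j e k₁ k₂ m₁ m₂ h ε]

end

/-- The part of the encoding of an instance that belongs to one agent. -/
def block (J : List Job) : List ℕ :=
  J.length :: J.flatMap fun j => [j.release, j.deadline, j.processing]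

theorem length_block (J : List Job) : (block J).length = 1 + (J.length + J.length + J.length) := by
  rw [block, List.length_cons, List.length_flatMap]
  simp
  omega

theorem getD_flatMap_job (J : List Job) (j c : ℕ) (hj : j < J.length) (hc : c < 3) :
    (J.flatMap fun j => [j.release, j.deadline, j.processing]).getD (j + j + j + c) 0 =
      [J[j].release, J[j].deadline, J[j].processing].getD c 0 := by
  induction J generalizing j with
  | nil => simp at hj
  | cons a J ih =>
    rw [List.flatMap_cons]
    cases j with
    | zero =>
      rw [List.getD_append _ _ _ _ (by simpa using hc)]
      simp
    | succ j =>
      rw [List.getD_append_right _ _ _ _ (by simp; omega)]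
      have := ih j (by simpa using hj)
      simp only [List.getElem_cons_succ, List.length_cons, List.length_nil]
      rw [← this]
      congr 1
      omega

theorem encode_single (N l : ℕ) (A : List (List Job)) :
    (⟨N, [l], A⟩ : Instance).encode = [N, 1, l, A.length] ++ A.flatMap block := rfl

section

variable {N l : ℕ} {A : List (List Job)} {x : ℕ → ℕ} {M : ℕ}

theorem encode_block (hx : ∀ i, x i = (⟨N, [l], A⟩ : Instance).encode.getD i 0) {i : ℕ}
    (hi : i < A.length) {c : ℕ} (hc : c < (block A[i]).length) :
    x (4 + ((A.take i).flatMap block).length + c) = (block A[i]).getD c 0 := by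
  have hA : A.flatMap block = (A.take i).flatMap block ++ (block A[i] ++
      (A.drop (i + 1)).flatMap block) := by
    conv_lhs => rw [← List.take_append_drop i A, List.drop_eq_getElem_cons hi]
    rw [List.flatMap_append, List.flatMap_cons]
  rw [hx, encode_single, hA, List.getD_append_right _ _ _ _ (by simp; omega),
    List.getD_append_right _ _ _ _ (by simp; omega), List.getD_append _ _ _ _ (by simp; omega)]
  congr 1
  simp
  omega

theorem agentPos_eq (hx : ∀ i, x i = (⟨N, [l], A⟩ : Instance).encode.getD i 0) {i : ℕ}
    (hi : i < A.length) (hM : A.length ≤ M) :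
    agentPos x M i = 4 + ((A.take i).flatMap block).length := by
  have key : ∀ m, Nat.rec (motive := fun _ => ℕ) 4
      (fun k acc => if k < i then acc + 1 + (x acc + x acc + x acc) else acc) m =
      4 + ((A.take (min m i)).flatMap block).length := by
    intro m
    induction m with
    | zero => simp
    | succ m ih =>
      dsimp only
      rw [ih]
      split_ifs with h
      · have hm : m < A.length := by omega
        have := encode_block hx hm (c := 0) (by rw [length_block]; omega)
        rw [min_eq_left h.le, min_eq_left (by omega : m + 1 ≤ i), List.take_add_one,
          List.getElem?_eq_getElem hm, Option.toList_some, List.flatMap_append, List.length_append,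
          List.flatMap_singleton, length_block]
        rw [add_zero] at this
        rw [this]
        simp only [block, List.getD_cons_zero]
        omega
      · rw [min_eq_right (by omega : i ≤ m), min_eq_right (by omega : i ≤ m + 1)]
  rw [agentPos, key, min_eq_right (by omega : i ≤ M)]

theorem encode_agent (hx : ∀ i, x i = (⟨N, [l], A⟩ : Instance).encode.getD i 0) {i : ℕ}
    (hi : i < A.length) (hM : A.length ≤ M) :
    relAt x M i = rel A[i] ∧ dlAt x M i = dl N A[i] ∧ procAt x M i = proc A[i] := by
  have hpos := agentPos_eq hx hi hM
  have hlen : x (agentPos x M i) = A[i].length := by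
    have := encode_block hx hi (c := 0) (by rw [length_block]; omega)
    rw [hpos]
    exact this
  have hdata : ∀ j (hj : j < A[i].length) c, c < 3 → x (agentPos x M i + (1 + c) + (j + j + j)) =
      [A[i][j].release, A[i][j].deadline, A[i][j].processing].getD c 0 := by
    intro j hj c hc
    rw [← getD_flatMap_job A[i] j c hj hc]
    have := encode_block hx hi (c := j + j + j + c + 1) (by rw [length_block]; omega)
    rw [block, List.getD_cons_succ] at this
    rw [← this, hpos]
    congr 1
    omega
  have h0 : x 0 = N := by rw [hx]; rfl
  refine ⟨funext fun j => ?_, funext fun j => ?_, funext fun j => ?_⟩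
  · rw [relAt, hlen]
    split_ifs with hj
    · have := hdata j hj 0 (by norm_num)
      simpa [rel, hj] using this
    · rw [rel_of_le (by omega)]
  · rw [dlAt, hlen]
    split_ifs with hj
    · have := hdata j hj 1 (by norm_num)
      rw [h0, show agentPos x M i + 2 = agentPos x M i + (1 + 1) from rfl, this]
      simp [dl, hj]
    · rw [dl_of_le (by omega)]
  · rw [procAt, hlen]
    split_ifs with hj
    · have := hdata j hj 2 (by norm_num)
      rw [show agentPos x M i + 3 = agentPos x M i + (1 + 2) from rfl, this]
      simp [proc, hj]
    · rw [proc_of_le (by omega)]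

theorem length_encode (hM : M = (⟨N, [l], A⟩ : Instance).encode.length + N.size) :
    M = 4 + (A.flatMap block).length + N.size := by
  rw [hM, encode_single, List.length_append]
  simp

theorem length_agents_le (A : List (List Job)) : A.length ≤ (A.flatMap block).length := by
  induction A with
  | nil => simp
  | cons J A ih => rw [List.flatMap_cons, List.length_append, length_block, List.length_cons]; omega

theorem length_jobs_lt {J : List Job} (hJ : J ∈ A) : J.length < (A.flatMap block).length := by
  induction A with
  | nil => simp at hJ
  | cons J' A ih =>
    rw [List.flatMap_cons, List.length_append, length_block]
    rcases List.mem_cons.1 hJ with rfl | h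
    · omega
    · have := ih h; omega

end

end PSBA

/-! ### The programs -/

namespace PSBA

open RAM Env

section

variable {Γ : Type} [Env Γ] {a b i j k e t w δ h ε N l T k₁ k₂ m₁ m₂ : Γ → ℕ}

theorem comp_raw (n : ℕ) : Comp fun γ : Γ => raw γ n := (Comp.lit n).get

theorem comp_thrice (hj : Comp j) : Comp fun γ => j γ + j γ + j γ := (hj.add hj).add hj

theorem comp_agentPos (hi : Comp i) : Comp fun γ => agentPos (raw γ) (bnd γ) (i γ) :=
  Comp.fold (f := fun γ k acc => if k < i γ then
      acc + 1 + (raw γ acc + raw γ acc + raw γ acc) else acc) (Comp.lit 4)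
    (Comp.ite (Comp.last.weak.lt hi.weak.weak)
      ((Comp.last.add (Comp.lit 1)).add (comp_thrice Comp.last.get)) Comp.last)

theorem comp_relAt (hi : Comp i) (hj : Comp j) :
    Comp fun γ => relAt (raw γ) (bnd γ) (i γ) (j γ) :=
  Comp.ite (hj.lt (comp_agentPos hi).get)
    (((comp_agentPos hi).add (Comp.lit 1)).add (comp_thrice hj)).get (Comp.lit 1)

theorem comp_dlAt (hi : Comp i) (hj : Comp j) :
    Comp fun γ => dlAt (raw γ) (bnd γ) (i γ) (j γ) :=
  Comp.ite (hj.lt (comp_agentPos hi).get)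
    ((((comp_agentPos hi).add (Comp.lit 2)).add (comp_thrice hj)).get.min (comp_raw 0))
    (Comp.lit 0)

theorem comp_procAt (hi : Comp i) (hj : Comp j) :
    Comp fun γ => procAt (raw γ) (bnd γ) (i γ) (j γ) :=
  Comp.ite (hj.lt (comp_agentPos hi).get)
    (((comp_agentPos hi).add (Comp.lit 3)).add (comp_thrice hj)).get (Comp.lit 0)

theorem comp_load (hi : Comp i) (ha : Comp a) (hb : Comp b) :
    Comp fun γ => load (bnd γ) (relAt (raw γ) (bnd γ) (i γ)) (dlAt (raw γ) (bnd γ) (i γ))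
      (procAt (raw γ) (bnd γ) (i γ)) (a γ) (b γ) :=
  Comp.sum (f := fun γ m => if a γ ≤ relAt (raw γ) (bnd γ) (i γ) m then
      (if dlAt (raw γ) (bnd γ) (i γ) m ≤ b γ then procAt (raw γ) (bnd γ) (i γ) m else 0) else 0)
    (Comp.iteLe ha.weak (comp_relAt hi.weak Comp.last)
      (Comp.iteLe (comp_dlAt hi.weak Comp.last) hb.weak (comp_procAt hi.weak Comp.last)
        (Comp.lit 0)) (Comp.lit 0))

theorem comp_eventSize (hN : Comp N) (hl : Comp l) (ht : Comp t) :
    Comp fun γ => min (t γ + l γ) (N γ + 1) - t γ :=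
  ((ht.add hl).min (hN.add (Comp.lit 1))).sub ht

theorem comp_capacity (hN : Comp N) (hl : Comp l) (ha : Comp a) (hb : Comp b) (hw : Comp w)
    (ht : Comp t) : Comp fun γ => capacity (N γ) (l γ) (a γ) (b γ) (w γ) (t γ) :=
  ((comp_eventSize hN hl ht).add ((hb.add (Comp.lit 1)).sub ha)).sub
    (hw.add (((hb.add (Comp.lit 1)).min (ht.add hl)).sub (ha.max ht)))

theorem comp_jobCapacity (hi : Comp i) (hj : Comp j) (hk : Comp k) (ht : Comp t) :
    Comp fun γ => jobCapacity (bnd γ) (raw γ 0) (raw γ 2) (relAt (raw γ) (bnd γ) (i γ))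
      (dlAt (raw γ) (bnd γ) (i γ)) (procAt (raw γ) (bnd γ) (i γ)) (j γ) (k γ) (t γ) :=
  comp_capacity (comp_raw 0) (comp_raw 2) (comp_relAt hi hj) (comp_dlAt hi hk)
    (comp_load hi (comp_relAt hi hj) (comp_dlAt hi hk)) ht

theorem comp_minOver {f : Γ → ℕ → ℕ} (ha : Comp a) (hf : Comp fun p : Γ × ℕ => f p.1 p.2) :
    Comp fun γ => minOver (bnd γ) (a γ) (f γ) :=
  Comp.fold (f := fun γ i acc => min acc (f γ i)) ha (Comp.last.min hf.weak)

theorem comp_agreementAt (hi : Comp i) (ht : Comp t) :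
    Comp fun γ => agreementAt (raw γ) (bnd γ) (i γ) (t γ) :=
  have hs := comp_eventSize (comp_raw 0) (comp_raw 2) ht
  comp_minOver hs (comp_minOver hs.weak
    (comp_jobCapacity hi.weak.weak Comp.last.weak Comp.last ht.weak.weak))

theorem comp_totalAt (ht : Comp t) : Comp fun γ => totalAt (raw γ) (bnd γ) (t γ) :=
  Comp.sum (f := fun γ i => if i < raw γ 3 then agreementAt (raw γ) (bnd γ) i (t γ) else 0)
    (Comp.ite (Comp.last.lt (comp_raw 3)) (comp_agreementAt Comp.last ht.weak) (Comp.lit 0))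

theorem comp_two_pow (hk : Comp k) : Comp fun γ => 2 ^ min (k γ) (bnd γ) :=
  (Comp.fold (f := fun γ i acc => if i < k γ then acc + acc else acc) (Comp.lit 1)
    (Comp.ite (Comp.last.weak.lt hk.weak.weak) (Comp.last.add Comp.last) Comp.last)).of_eq
  fun γ => by
    induction bnd γ with
    | zero => simp
    | succ n ih =>
      dsimp only
      rw [ih]
      split_ifs with h
      · rw [min_eq_right h.le, min_eq_right (by omega : n + 1 ≤ k γ), pow_succ]; omega
      · rw [min_eq_left (by omega : k γ ≤ n), min_eq_left (by omega : k γ ≤ n + 1)]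

theorem comp_halve (ha : Comp a) : Comp fun γ => halve (bnd γ) (a γ) :=
  have hq : Comp fun p : (Γ × ℕ) × ℕ => p.2 + 2 ^ min (bnd p - (p.1.2 + 1)) (bnd p) :=
    Comp.last.add (comp_two_pow (Comp.bound.sub (Comp.last.weak.add (Comp.lit 1))))
  Comp.fold (f := fun γ i acc =>
      if a γ < acc + 2 ^ min (bnd γ - (i + 1)) (bnd γ) + (acc + 2 ^ min (bnd γ - (i + 1)) (bnd γ))
      then acc else acc + 2 ^ min (bnd γ - (i + 1)) (bnd γ)) (Comp.lit 0)
    (Comp.ite (ha.weak.weak.lt (hq.add hq)) Comp.last hq)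

theorem comp_breakpoint (hN : Comp N) (hl : Comp l) (ha : Comp a) (hb : Comp b) (he : Comp e) :
    Comp fun γ => breakpoint (N γ) (l γ) (a γ) (b γ) (e γ) :=
  Comp.ite (he.eq (Comp.lit 0)) ha <| Comp.ite (he.eq (Comp.lit 1)) (ha.sub hl) <|
  Comp.ite (he.eq (Comp.lit 2)) (hb.add (Comp.lit 1)) <|
  Comp.ite (he.eq (Comp.lit 3)) ((hb.add (Comp.lit 1)).sub hl) <|
  Comp.ite (he.eq (Comp.lit 4)) ((hN.add (Comp.lit 1)).sub hl) hN

theorem comp_candidateAt (hi : Comp i) (hT : Comp T) (hj : Comp j) (he : Comp e) (hk₁ : Comp k₁)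
    (hk₂ : Comp k₂) (hm₁ : Comp m₁) (hm₂ : Comp m₂) (hh : Comp h) (hε : Comp ε) :
    Comp fun γ => candidateAt (raw γ) (bnd γ) (i γ) (T γ) (j γ) (e γ) (k₁ γ) (k₂ γ) (m₁ γ) (m₂ γ)
      (h γ) (ε γ) :=
  have hu := comp_breakpoint (comp_raw 0) (comp_raw 2) (comp_relAt hi hj) (comp_dlAt hi hj) he
  have hδ := (comp_jobCapacity hi hm₁ hm₂ hu).sub (comp_jobCapacity hi hk₁ hk₂ hu)
  ((((hu.add (Comp.ite (hh.eq (Comp.lit 0)) hδ (comp_halve hδ))).add hε).sub (Comp.lit 1)).max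
    (Comp.lit 1)).min hT

/-- The function `f` to be maximized has to be computable in every context `Δ` that extends `Γ` and
shares its input, as it is evaluated inside the loops over the candidates. -/
theorem comp_maxOverCandidates {f : Γ → ℕ → ℕ}
    (hf : ∀ (Δ : Type) [Env Δ] (π : Δ → Γ) (_ : ∀ δ, raw (π δ) = raw δ ∧ bnd (π δ) = bnd δ)
      (t : Δ → ℕ), Comp t → Comp fun δ => f (π δ) (t δ)) :
    Comp fun γ => maxOverCandidates (raw γ) (bnd γ) (f γ) :=
  Comp.sup <| Comp.sup <| Comp.sup <| Comp.sup <| Comp.sup <| Comp.sup <| Comp.sup <| Comp.sup <|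
    Comp.sup <| hf _ (fun p => p.1.1.1.1.1.1.1.1.1) (fun _ => ⟨rfl, rfl⟩) _ <|
    comp_candidateAt Comp.last.weak.weak.weak.weak.weak.weak.weak.weak
      ((Comp.lit 1).max (((comp_raw 0).add (Comp.lit 1)).sub (comp_raw 2)))
      Comp.last.weak.weak.weak.weak.weak.weak.weak Comp.last.weak.weak.weak.weak.weak.weak
      Comp.last.weak.weak.weak.weak.weak Comp.last.weak.weak.weak.weak Comp.last.weak.weak.weak
      Comp.last.weak.weak Comp.last.weak Comp.last

theorem comp_bestCandidate : Comp fun γ : Γ => bestCandidate (raw γ) (bnd γ) := by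
  refine comp_maxOverCandidates (f := fun γ t => if totalAt (raw γ) (bnd γ) t =
      maxOverCandidates (raw γ) (bnd γ) (totalAt (raw γ) (bnd γ)) then t else 0)
    fun Δ _ π hπ t ht => ?_
  simp only [hπ]
  refine Comp.ite ((comp_totalAt ht).eq (comp_maxOverCandidates
    (f := fun γ => totalAt (raw γ) (bnd γ)) fun Δ' _ π' hπ' t' ht' => ?_)) ht (Comp.lit 0)
  simp only [hπ']
  exact comp_totalAt ht'

theorem emits_candidateList : Emits fun γ : Γ =>
    (candidateList (raw γ) (bnd γ)).flatMap fun t => [t, agreementAt (raw γ) (bnd γ) 0 t] := by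
  simp only [candidateList, List.flatMap_assoc, List.flatMap_singleton]
  refine Emits.flatMap <| Emits.flatMap <| Emits.flatMap <| Emits.flatMap <| Emits.flatMap <|
    Emits.flatMap <| Emits.flatMap <| Emits.flatMap ?_
  have hc := comp_candidateAt (Γ := (((((((Γ × ℕ) × ℕ) × ℕ) × ℕ) × ℕ) × ℕ) × ℕ) × ℕ)
    (Comp.lit 0) (comp_raw 0)
    Comp.last.weak.weak.weak.weak.weak.weak.weak Comp.last.weak.weak.weak.weak.weak.weak
    Comp.last.weak.weak.weak.weak.weak Comp.last.weak.weak.weak.weak Comp.last.weak.weak.weak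
    Comp.last.weak.weak Comp.last.weak Comp.last
  exact (Emits.single hc).append (Emits.single (comp_agreementAt (Comp.lit 0) hc))

end

end PSBA

/-! ### Correctness of the programs -/

namespace PSBA

open RAM

section

variable {x : ℕ → ℕ} {M : ℕ}

theorem exists_sup_range_eq (hM : 0 < M) (f : ℕ → ℕ) :
    ∃ i < M, (Finset.range M).sup f = f i := by
  obtain ⟨i, hi, h⟩ := Finset.exists_mem_eq_sup (Finset.range M) ⟨0, Finset.mem_range.2 hM⟩ f
  exact ⟨i, Finset.mem_range.1 hi, h⟩

theorem exists_maxOverCandidates_eq (hM : 0 < M) (f : ℕ → ℕ) :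
    ∃ i < M, ∃ t, IsCandidate M (x 0) (x 2) (relAt x M i) (dlAt x M i) (procAt x M i) M
      (max 1 (x 0 + 1 - x 2)) t ∧ maxOverCandidates x M f = f t := by
  unfold maxOverCandidates
  obtain ⟨i, hi, h⟩ := exists_sup_range_eq hM _; rw [h]
  obtain ⟨j, hj, h⟩ := exists_sup_range_eq hM _; rw [h]
  obtain ⟨e, he, h⟩ := exists_sup_range_eq hM _; rw [h]
  obtain ⟨k₁, hk₁, h⟩ := exists_sup_range_eq hM _; rw [h]
  obtain ⟨k₂, hk₂, h⟩ := exists_sup_range_eq hM _; rw [h]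
  obtain ⟨m₁, hm₁, h⟩ := exists_sup_range_eq hM _; rw [h]
  obtain ⟨m₂, hm₂, h⟩ := exists_sup_range_eq hM _; rw [h]
  obtain ⟨c, hc, h⟩ := exists_sup_range_eq hM _; rw [h]
  obtain ⟨ε, hε, h⟩ := exists_sup_range_eq hM _; rw [h]
  exact ⟨i, hi, _, ⟨j, hj, e, he, k₁, hk₁, k₂, hk₂, m₁, hm₁, m₂, hm₂, c, hc, ε, hε, rfl⟩, rfl⟩

theorem le_maxOverCandidates {i t : ℕ} (hi : i < M)
    (h : IsCandidate M (x 0) (x 2) (relAt x M i) (dlAt x M i) (procAt x M i) M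
      (max 1 (x 0 + 1 - x 2)) t) (f : ℕ → ℕ) : f t ≤ maxOverCandidates x M f := by
  obtain ⟨j, hj, e, he, k₁, hk₁, k₂, hk₂, m₁, hm₁, m₂, hm₂, c, hc, ε, hε, rfl⟩ := h
  exact Finset.le_sup_of_le (Finset.mem_range.2 hi) <| Finset.le_sup_of_le (Finset.mem_range.2 hj) <|
    Finset.le_sup_of_le (Finset.mem_range.2 he) <| Finset.le_sup_of_le (Finset.mem_range.2 hk₁) <|
    Finset.le_sup_of_le (Finset.mem_range.2 hk₂) <| Finset.le_sup_of_le (Finset.mem_range.2 hm₁) <|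
    Finset.le_sup_of_le (Finset.mem_range.2 hm₂) <| Finset.le_sup_of_le (Finset.mem_range.2 hc) <|
    Finset.le_sup_of_le (Finset.mem_range.2 hε) le_rfl

theorem IsCandidate.mem {N l : ℕ} {r d p : ℕ → ℕ} {K T t : ℕ} (hT : 1 ≤ T)
    (h : IsCandidate M N l r d p K T t) : 1 ≤ t ∧ t ≤ T := by
  obtain ⟨j, -, e, -, k₁, -, k₂, -, m₁, -, m₂, -, c, -, ε, -, rfl⟩ := h
  exact candidate_mem hT ..

/-- The slot that is found is a candidate in `1, …, T` at which the sum of the agreement functions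
is at least as large as at any other candidate. -/
theorem bestCandidate_spec (hM : 0 < M) :
    1 ≤ bestCandidate x M ∧ bestCandidate x M ≤ max 1 (x 0 + 1 - x 2) ∧
    ∀ i < M, ∀ t, IsCandidate M (x 0) (x 2) (relAt x M i) (dlAt x M i) (procAt x M i) M
      (max 1 (x 0 + 1 - x 2)) t → totalAt x M t ≤ totalAt x M (bestCandidate x M) := by
  set f : ℕ → ℕ := fun t =>
    if totalAt x M t = maxOverCandidates x M (totalAt x M) then t else 0 with hf
  obtain ⟨i, hi, t, ht, hV⟩ := exists_maxOverCandidates_eq (x := x) hM (totalAt x M)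
  obtain ⟨i', hi', t', ht', hW⟩ := exists_maxOverCandidates_eq (x := x) hM f
  have hb : bestCandidate x M = f t' := hW
  have h₁ := ht.mem (le_max_left _ _)
  have h₁' := ht'.mem (le_max_left _ _)
  have hle := le_maxOverCandidates hi ht f
  rw [hW, ← hb] at hle
  have hft : f t = t := if_pos hV.symm
  have hft' : f t' = t' ∧ totalAt x M t' = maxOverCandidates x M (totalAt x M) := by
    by_cases h : totalAt x M t' = maxOverCandidates x M (totalAt x M)
    · exact ⟨if_pos h, h⟩
    · have : f t' = 0 := if_neg h
      omega
  rw [hb, hft'.1]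
  refine ⟨h₁'.1, h₁'.2, fun k hk u hu => ?_⟩
  rw [hft'.2]
  exact le_maxOverCandidates hk hu _

theorem mem_candidateList {t : ℕ} : t ∈ candidateList x M ↔
    IsCandidate M (x 0) (x 2) (relAt x M 0) (dlAt x M 0) (procAt x M 0) M (x 0) t := by
  simp only [candidateList, List.mem_flatMap, List.mem_range, List.mem_singleton, IsCandidate,
    candidateAt, @eq_comm _ t]

end

section

variable {N l : ℕ} {A : List (List Job)} {x : ℕ → ℕ} {M : ℕ}

/-- What is used of the encoding of an instance and of the bound on loops. -/
theorem encode_spec (hN : 1 ≤ N) (hx : x = (Input.ofList (⟨N, [l], A⟩ : Instance).encode).raw)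
    (hM : M = (Input.ofList (⟨N, [l], A⟩ : Instance).encode).bnd) :
    x 0 = N ∧ x 2 = l ∧ x 3 = A.length ∧ A.length < M ∧ 2 * N < 2 ^ M ∧
      (∀ J ∈ A, J.length + 6 ≤ M) ∧
      ∀ i (hi : i < A.length),
        relAt x M i = rel A[i] ∧ dlAt x M i = dl N A[i] ∧ procAt x M i = proc A[i] := by
  have hM' := length_encode (N := N) (l := l) (A := A) (M := M) (by rw [hM]; rfl)
  have hA := length_agents_le A
  have hsize : 0 < N.size := Nat.size_pos.2 hN
  have hpow : 2 * N < 2 ^ M := by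
    have h₁ := Nat.lt_size_self N
    have h₂ : 2 ^ (N.size + 1) ≤ 2 ^ M := Nat.pow_le_pow_right (by norm_num) (by omega)
    rw [pow_succ] at h₂
    omega
  refine ⟨by rw [hx]; rfl, by rw [hx]; rfl, by rw [hx]; rfl, by omega, hpow, fun J hJ => ?_,
    fun i hi => encode_agent (fun i => by rw [hx]; rfl) hi (by omega)⟩
  have := length_jobs_lt hJ
  omega

theorem agreementAt_eq (hI : (⟨N, [l], A⟩ : Instance).Valid)
    (hx : x = (Input.ofList (⟨N, [l], A⟩ : Instance).encode).raw)
    (hM : M = (Input.ofList (⟨N, [l], A⟩ : Instance).encode).bnd) {i : ℕ} (hi : i < A.length)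
    {t : ℕ} (ht : 1 ≤ t) (htN : t ≤ N) :
    agreementAt x M i t = (⟨N, [l], A⟩ : Instance).g A[i] t := by
  obtain ⟨h0, h2, -, -, -, hJ, hdata⟩ := encode_spec hI.1 hx hM
  obtain ⟨h₁, h₂, h₃⟩ := hdata i hi
  have := hJ _ (List.getElem_mem hi)
  rw [g_eq hI (List.getElem_mem hi) (by omega : A[i].length < M) ht htN, agreementAt, h0, h2, h₁,
    h₂, h₃]

theorem totalAt_eq (hI : (⟨N, [l], A⟩ : Instance).Valid)
    (hx : x = (Input.ofList (⟨N, [l], A⟩ : Instance).encode).raw)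
    (hM : M = (Input.ofList (⟨N, [l], A⟩ : Instance).encode).bnd) {t : ℕ} (ht : 1 ≤ t)
    (htN : t ≤ N) :
    totalAt x M t = (A.map fun J => (⟨N, [l], A⟩ : Instance).g J t).sum := by
  obtain ⟨-, -, h3, hAM, -⟩ := encode_spec hI.1 hx hM
  rw [totalAt, h3, ← Finset.sum_subset (Finset.range_subset_range.2 hAM.le), Finset.sum_range,
    ← Fin.sum_univ_fun_getElem]
  · refine Finset.sum_congr rfl fun i _ => ?_
    rw [if_pos i.2, agreementAt_eq hI hx hM i.2 ht htN]
  · intro i _ hi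
    rw [Finset.mem_range] at hi
    rw [if_neg hi]

/-- The slot that is found maximizes the sum of the agreement functions. -/
theorem bestCandidate_optimal (hI : (⟨N, [l], A⟩ : Instance).Valid)
    (hx : x = (Input.ofList (⟨N, [l], A⟩ : Instance).encode).raw)
    (hM : M = (Input.ofList (⟨N, [l], A⟩ : Instance).encode).bnd) :
    1 ≤ bestCandidate x M ∧ bestCandidate x M ≤ lastStart N l ∧ ∀ t, 1 ≤ t → t ≤ N →
      (A.map fun J => (⟨N, [l], A⟩ : Instance).g J t).sum ≤
        (A.map fun J => (⟨N, [l], A⟩ : Instance).g J (bestCandidate x M)).sum := by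
  obtain ⟨h0, h2, h3, hAM, hpow, hJM, hdata⟩ := encode_spec hI.1 hx hM
  obtain ⟨h₁, hT, hmax⟩ := bestCandidate_spec (x := x) (by omega : 0 < M)
  have hN : 1 ≤ N := hI.1
  have hl : 1 ≤ l := hI.2.1 l (by simp)
  rw [h0, h2] at hT hmax
  change bestCandidate x M ≤ lastStart N l at hT
  have hTN : 1 ≤ lastStart N l ∧ lastStart N l ≤ N := by unfold lastStart; omega
  refine ⟨h₁, hT, fun t ht htN => ?_⟩
  rcases A.eq_nil_or_concat with hA | ⟨_, _, hA⟩
  · simp [hA]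
  have hpos : 0 < A.length := by rw [hA]; simp
  obtain ⟨t₀, ht₁, htT, hcase, hopt⟩ := exists_optimal hI
  refine (hopt t ht htN).trans ?_
  rw [← totalAt_eq hI hx hM ht₁ (by omega), ← totalAt_eq hI hx hM h₁ (by omega)]
  obtain ⟨i, hi, hc⟩ : ∃ i, ∃ hi : i < A.length, IsCandidate M N l (rel A[i]) (dl N A[i])
      (proc A[i]) (A[i].length + 6) (lastStart N l) t₀ := by
    have hone : ∀ u, u = 1 → ∃ i, ∃ hi : i < A.length, IsCandidate M N l (rel A[i]) (dl N A[i])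
        (proc A[i]) (A[i].length + 6) (lastStart N l) u := by
      rintro u rfl
      exact ⟨0, hpos, isCandidate_breakpoint (j := A[0].length) (e := 0) (by omega) (by omega)
        (by omega) (rel_of_le le_rfl) le_rfl hTN.1⟩
    rcases hcase with h | h | ⟨J, hJ, h⟩
    · exact hone _ h
    · by_cases hlN : l ≤ N
      · refine ⟨0, hpos, isCandidate_breakpoint (j := 0) (e := 4) (by omega) (by omega)
          (by omega) ?_ ht₁ htT⟩
        simp only [breakpoint, h, lastStart, OfNat.ofNat_ne_zero, OfNat.ofNat_ne_one, if_false,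
          show (4 : ℕ) ≠ 2 by norm_num, show (4 : ℕ) ≠ 3 by norm_num, if_true]
        omega
      · exact hone _ (by rw [h]; unfold lastStart; omega)
    · obtain ⟨i, hi, rfl⟩ := List.getElem_of_mem hJ
      have hlen := hJM _ hJ
      exact ⟨i, hi, isCandidate_of_turning (hI.2.2 _ hJ).1 (hI.2.2 _ hJ).2 hl (by omega) hpow
        (fun t ht htN => g_eq hI hJ (by omega) ht htN) htT h⟩
  obtain ⟨e₁, e₂, e₃⟩ := hdata i hi
  refine hmax i (by omega) t₀ ?_
  rw [e₁, e₂, e₃]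
  exact hc.mono (hJM _ (List.getElem_mem hi))

theorem schedule_eq_const {I : Instance} (hI : I.events.length = 1) (τ : I.EventSchedule) :
    ∃ t, τ = fun _ => t :=
  ⟨τ ⟨0, by omega⟩, funext fun e => congrArg τ (Fin.ext (by have := e.2; simp; omega))⟩

end

end PSBA

theorem mainTheorem4 :
    -- an optimal position of the event is computed in polynomial time
    (∃ (c : RAM.Program) (q : Polynomial ℕ), ∀ I : PSBA.Instance,
      I.Valid → I.events.length = 1 →
        ∃ t : ℕ, c.OutputsWithin I.encode [t] (q.eval (RAM.bitSize I.encode)) ∧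
          I.IsOptimal (fun _ => t) ∧ I.StaysInside (fun _ => t)) ∧
    -- each agreement function is piecewise linear, with polynomially many turning points
    (∃ q : Polynomial ℕ, ∀ I : PSBA.Instance, I.Valid → I.events.length = 1 →
      ∀ J ∈ I.agents,
        PSBA.LinearBetween ({1, I.horizon} ∪ PSBA.turningPoints I.horizon (I.g J)) (I.g J) ∧
        (PSBA.turningPoints I.horizon (I.g J)).card ≤ q.eval J.length) ∧
    -- the agreement function of an agent is drawn in polynomial time
    (∃ (c : RAM.Program) (q : Polynomial ℕ), ∀ I : PSBA.Instance,
      I.Valid → I.events.length = 1 → ∀ J : List PSBA.Job, I.agents = [J] →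
        ∃ L : List ℕ,
          c.OutputsWithin I.encode (L.flatMap fun t => [t, I.g J t])
            (q.eval (RAM.bitSize I.encode)) ∧
          (∀ t ∈ L, t ∈ PSBA.timeline I.horizon) ∧
          1 ∈ L ∧ I.horizon ∈ L ∧
          ∀ t ∈ PSBA.turningPoints I.horizon (I.g J), t ∈ L) := by

  refine ⟨?_, ?_, ?_⟩
  · obtain ⟨c, q, hc⟩ := (RAM.Emits.single PSBA.comp_bestCandidate).exists_program
    refine ⟨c, q, fun I hI hev => ⟨_, hc I.encode, ?_⟩⟩
    obtain ⟨N, ev, A⟩ := I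
    obtain ⟨l, rfl⟩ := List.length_eq_one_iff.1 hev
    set t := PSBA.bestCandidate (RAM.Input.ofList (PSBA.Instance.encode ⟨N, [l], A⟩)).raw
      (RAM.Input.ofList (PSBA.Instance.encode ⟨N, [l], A⟩)).bnd with ht
    change PSBA.Instance.IsOptimal ⟨N, [l], A⟩ (fun _ => t) ∧
      PSBA.Instance.StaysInside ⟨N, [l], A⟩ (fun _ => t)
    obtain ⟨h₁, hT, hmax⟩ := PSBA.bestCandidate_optimal hI rfl rfl
    rw [← ht] at h₁ hT hmax
    have hN : 1 ≤ N := hI.1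
    have hl : 1 ≤ l := hI.2.1 l (by simp)
    unfold PSBA.lastStart at hT
    refine ⟨⟨fun _ => Finset.mem_Icc.2 ⟨h₁, ?_⟩, fun τ hτ => ?_⟩, ?_⟩
    · change t ≤ N
      omega
    · obtain ⟨u, rfl⟩ := PSBA.schedule_eq_const hev τ
      have hu := Finset.mem_Icc.1 (hτ ⟨0, by simp⟩)
      exact hmax u hu.1 hu.2
    · rintro ⟨e, he⟩ hle
      have he' : e = 0 := by simpa using he
      subst he'
      change l ≤ N at hle
      change t + l ≤ N + 1
      omega
  · refine ⟨(Polynomial.X + 6) ^ 8, fun I hI hev J hJ => ⟨PSBA.linearBetween_turningPoints _ _, ?_⟩⟩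
    obtain ⟨N, ev, A⟩ := I
    obtain ⟨l, rfl⟩ := List.length_eq_one_iff.1 hev
    have hM : 2 * N < 2 ^ (J.length + 1 + 2 * N) :=
      lt_of_lt_of_le (by omega) (Nat.lt_two_pow_self (n := J.length + 1 + 2 * N)).le
    have := PSBA.card_le_of_isCandidate fun t ht => PSBA.isCandidate_of_turning (T := N)
      (hI.2.2 J hJ).1 (hI.2.2 J hJ).2 (hI.2.1 l (by simp)) (by omega) hM
      (fun t ht htN => PSBA.g_eq hI hJ (by omega) ht htN)
      (Finset.mem_Ioo.1 (Finset.mem_filter.1 ht).1).2.le ht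
    simp only [Polynomial.eval_pow, Polynomial.eval_add, Polynomial.eval_X, Polynomial.eval_ofNat]
    exact this
  · obtain ⟨c, q, hc⟩ := (PSBA.emits_candidateList (Γ := RAM.Input)).exists_program
    refine ⟨c, q, fun I hI hev J hJ => ?_⟩
    obtain ⟨N, ev, A⟩ := I
    obtain ⟨l, rfl⟩ := List.length_eq_one_iff.1 hev
    obtain rfl : A = [J] := hJ
    set inp := PSBA.Instance.encode ⟨N, [l], [J]⟩ with hinp
    have hN : 1 ≤ N := hI.1
    obtain ⟨h0, h2, -, -, hpow, hJM, hdata⟩ := PSBA.encode_spec (l := l) (A := [J]) hN rfl rfl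
    rw [← hinp] at h0 h2 hpow hJM hdata
    have hlen := hJM J (by simp)
    obtain ⟨e₁, e₂, e₃⟩ := hdata 0 (by simp)
    rw [List.getElem_cons_zero] at e₁ e₂ e₃
    have hmem : ∀ t, t ∈ PSBA.candidateList (RAM.Input.ofList inp).raw (RAM.Input.ofList inp).bnd ↔
        PSBA.IsCandidate (RAM.Input.ofList inp).bnd N l (PSBA.rel J) (PSBA.dl N J) (PSBA.proc J)
          (RAM.Input.ofList inp).bnd N t := by
      intro t
      rw [PSBA.mem_candidateList, h0, h2, e₁, e₂, e₃]
    refine ⟨PSBA.candidateList (RAM.Input.ofList inp).raw (RAM.Input.ofList inp).bnd, ?_, ?_, ?_,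
      ?_, ?_⟩
    · have hout := hc inp
      convert hout using 1
      refine List.flatMap_congr fun t ht => ?_
      obtain ⟨h₁, h₂⟩ := ((hmem t).1 ht).mem hN
      have := PSBA.agreementAt_eq hI rfl rfl (i := 0) (by simp) h₁ h₂
      rw [← hinp, List.getElem_cons_zero] at this
      rw [← this]
      rfl
    · intro t ht
      exact Finset.mem_Icc.2 (((hmem t).1 ht).mem hN)
    · exact (hmem 1).2 (PSBA.isCandidate_breakpoint (j := J.length) (e := 0) (by omega) (by omega)
        (by omega) (PSBA.rel_of_le le_rfl) le_rfl hN)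
    · exact (hmem N).2 (PSBA.isCandidate_breakpoint (j := 0) (e := 5) (by omega) (by omega)
        (by omega) rfl hN le_rfl)
    · intro t ht
      exact (hmem t).2 ((PSBA.isCandidate_of_turning (hI.2.2 J (by simp)).1 (hI.2.2 J (by simp)).2
        (hI.2.1 l (by simp)) (by omega) hpow (fun t ht htN => PSBA.g_eq hI (by simp) (by omega) ht htN)
        (Finset.mem_Ioo.1 (Finset.mem_filter.1 ht).1).2.le ht).mono hlen)
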